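/- **Setting.** $\mathrm{Set}$ is the category of sets and $\mathrm{PO}$ the category of preordered sets and monotone maps; $\Delta:\mathrm{Set}\to\mathrm{PO}$ equips a set with its diagonal (equality) preorder. For a set $T$, $\Delta^T:\mathrm{Set}^T\to\mathrm{PO}^T$ is the induced functor on $T$-indexed families. A *relative monad* $P$ on a functor $F:\mathcal C\to\mathcal D$ consists of objects $P(X)\in\mathcal D$ for $X \in \mathcal C$, morphisms $\eta_X:FX\to PX$ and maps $\sigma_{X,Y}:\mathcal D(FX,PY)\to\mathcal D(PX,PY)$ with $\sigma(f)\circ\eta=f$, $\sigma(\eta)=\mathrm{id}$ and $\sigma(g)\circ\sigma(f)=\sigma(\sigma(g)\circ f)$; a relative monad on $\Delta^T$ is moreover required to have $\sigma$ monotone for the pointwise preorders on morphisms. A *$P$-module* with codomain $\mathcal E$ consists of objects $M(X)\in\mathcal E$ for $X\in\mathcal C$ and maps $\varsigma_{X,Y}:\mathcal D(FX,PY)\to\mathcal E(MX,MY)$ with $\varsigma(\eta)=\mathrm{id}$ and $\varsigma(g)\circ\varsigma(f)=\varsigma(\sigma(g)\circ f)$; module morphisms are families of morphisms $MX\to M'X$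 commuting with $\varsigma$. **1-signatures.** An algebraic signature $S$ is a family of natural numbers (arities of type constructors); its representations are sets with operations of these arities, and $S(n)$ is the set of terms over $S$ in $n$ variables, each $\tau\in S(n)$ giving, for every representation $T$ of $S$, a map $\tau:T^n\to T$. The *classic half-arities of degree $n$ over $S$* are generated inductively by: the constant $*$; the fibres $[\Theta_n]_\tau$ with $\tau\in S(n)$; the derivations $M^\tau$ with $\tau\in S(n)$; and binary products $M\times N$. For a representation $T$ of $S$ and a relative monad $P$ on $\Delta^T$ they denote the following modules with codomain $\mathrm{PO}$, on pairs $(V,\mathbf t)$ with $V\in\mathrm{Set}^T$ and $\mathbf t\in T^n$ (that is, families, indexed by $\mathbf t\in T^n$, of $P$-modules): the one-point preorder; $P(V)_{\tau(\mathbf t)}$; $M(V^{*\tau(\mathbf t)},\mathbf t)$, where $V^{*u}$ is $V$ with one additional element of type $u$; and the pointwise product. A *classic arity* of degree $n$ is a pair $\alpha=(\mathrm{dom}(\alpha),[\Theta_n]_\tau)$ of a classic half-arity of degree $n$ and a fibre with $\tau\in S(n)$. A *1-signature* $(S,\Sigma)$ consists of an algebraic signature $S$ and a family $\Sigma$ of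 classic arities over $S$, of varying degrees. **Representations.** A representation of $(S,\Sigma)$ is a representation of $S$ in a set $T$, a relative monad $P$ on $\Delta^T$, and for each arity $\alpha$ of $\Sigma$ a module morphism $\alpha^P:\mathrm{dom}(\alpha,P)\to\mathrm{cod}(\alpha,P)$. A morphism $(T,P)\to(T',Q)$ is a morphism $g:T\to T'$ of representations of $S$ together with a natural transformation $f_V:\vec g(P V)\to Q(\vec g V)$, where $\vec g$ denotes the retyping functors $\mathrm{Set}^T\to\mathrm{Set}^{T'}$ and $\mathrm{PO}^T\to\mathrm{PO}^{T'}$ (left Kan extension along $g$), such that $f$ is compatible with $\eta$ and $\sigma$ (a colax morphism of relative monads over $\vec g$) and commutes with the representations of all arities, $\mathrm{cod}(\alpha,f)\circ\alpha^P=\alpha^Q\circ\mathrm{dom}(\alpha,f)$. These form the category $\mathrm{Rep}^\Delta(S,\Sigma)$. **Lemma.** For every 1-signature $(S,\Sigma)$ the category $\mathrm{Rep}^\Delta(S,\Sigma)$ has an initial object. It is given by the freely generated types and terms with the equality preorder: there is an initial object whose underlying representation of $S$ is the initial representation of $S$; whose terms are freely generated from variables by the constructors of $\Sigma$, i.e.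 in every context $V$ each term is, in exactly one way, either a variable ($\eta$ of an element of $V$) or $\alpha^P_{V,\mathbf t}(a)$ for an arity $\alpha$, a tuple of types $\mathbf t$ and an argument $a\in\mathrm{dom}(\alpha,P)(V,\mathbf t)$, and structural induction over terms (in all contexts simultaneously) holds; and in which, for two terms $x,y$ of the same type in the same context, $x\le y$ if and only if $x=y$. -/

import Mathlib

open CategoryTheory

universe u v₁ v₂ v₃ v₄ v₅ v₆ u₁ u₂ u₃ u₄ u₅ u₆

/-! ### Relative monads, their colax morphisms, and modules -/

/-- A relative monad on a functor `F : C ⥤ D`, in Kleisli form. -/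
structure RelMonad {C : Type u₁} [Category.{v₁} C] {D : Type u₂} [Category.{v₂} D]
    (F : C ⥤ D) where
  obj : C → D
  unit : ∀ X, F.obj X ⟶ obj X
  bind : ∀ {X Y}, (F.obj X ⟶ obj Y) → (obj X ⟶ obj Y)
  unit_bind : ∀ {X Y} (f : F.obj X ⟶ obj Y), unit X ≫ bind f = f
  bind_unit : ∀ X, bind (unit X) = 𝟙 (obj X)
  bind_bind : ∀ {X Y Z} (f : F.obj X ⟶ obj Y) (g : F.obj Y ⟶ obj Z),
    bind f ≫ bind g = bind (f ≫ bind g)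

namespace RelMonad

variable {C : Type u₁} [Category.{v₁} C] {D : Type u₂} [Category.{v₂} D] {F : C ⥤ D}

/-- The functorial action of a relative monad. -/
def map (P : RelMonad F) {X Y : C} (f : X ⟶ Y) : P.obj X ⟶ P.obj Y :=
  P.bind (F.map f ≫ P.unit Y)

theorem map_bind (P : RelMonad F) {X Y Z : C} (f : X ⟶ Y) (g : F.obj Y ⟶ P.obj Z) :
    P.map f ≫ P.bind g = P.bind (F.map f ≫ g) := by
  simp [map, bind_bind, unit_bind]

theorem bind_map (P : RelMonad F) {X Y Z : C} (f : F.obj X ⟶ P.obj Y) (g : Y ⟶ Z) :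
    P.bind f ≫ P.map g = P.bind (f ≫ P.map g) := by
  simp [map, bind_bind]

theorem unit_map (P : RelMonad F) {X Y : C} (f : X ⟶ Y) :
    P.unit X ≫ P.map f = F.map f ≫ P.unit Y := by
  simp [map, unit_bind]

theorem map_id (P : RelMonad F) (X : C) : P.map (𝟙 X) = 𝟙 (P.obj X) := by
  simp [map, bind_unit]

theorem map_comp (P : RelMonad F) {X Y Z : C} (f : X ⟶ Y) (g : Y ⟶ Z) :
    P.map (f ≫ g) = P.map f ≫ P.map g := by
  simp [map, bind_bind, unit_bind]

end RelMonad

/-- A colax morphism `(G, G', N, τ)` from a relative monad `P` on `F` to a relative monad `Q` on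
`F'`, with the functors `G`, `G'` and the natural transformation `N` as parameters.  Naturality
of `τ` follows from the two diagrams, see `ColaxHom.naturality`. -/
@[ext]
structure ColaxHom {C : Type u₁} [Category.{v₁} C] {D : Type u₂} [Category.{v₂} D]
    {C' : Type u₃} [Category.{v₃} C'] {D' : Type u₄} [Category.{v₄} D']
    {F : C ⥤ D} {F' : C' ⥤ D'} (P : RelMonad F) (Q : RelMonad F')
    (G : C ⥤ C') (G' : D ⥤ D') (N : G ⋙ F' ⟶ F ⋙ G') where
  τ : ∀ c, G'.obj (P.obj c) ⟶ Q.obj (G.obj c)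
  bind_comm : ∀ {c d} (f : F.obj c ⟶ P.obj d),
    G'.map (P.bind f) ≫ τ d = τ c ≫ Q.bind (N.app c ≫ G'.map f ≫ τ d)
  unit_comm : ∀ c, N.app c ≫ G'.map (P.unit c) ≫ τ c = Q.unit (G.obj c)

namespace ColaxHom

variable {C : Type u₁} [Category.{v₁} C] {D : Type u₂} [Category.{v₂} D]
  {C' : Type u₃} [Category.{v₃} C'] {D' : Type u₄} [Category.{v₄} D']
  {C'' : Type u₅} [Category.{v₅} C''] {D'' : Type u₆} [Category.{v₆} D'']
  {F : C ⥤ D} {F' : C' ⥤ D'} {F'' : C'' ⥤ D''}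
  {P : RelMonad F} {Q : RelMonad F'} {R : RelMonad F''}
  {G : C ⥤ C'} {G' : D ⥤ D'} {N : G ⋙ F' ⟶ F ⋙ G'}
  {H : C' ⥤ C''} {H' : D' ⥤ D''} {M : H ⋙ F'' ⟶ F' ⋙ H'}

theorem naturality (h : ColaxHom P Q G G' N) {c d : C} (f : c ⟶ d) :
    G'.map (P.map f) ≫ h.τ d = h.τ c ≫ Q.map (G.map f) := by
  have := N.naturality f
  simp only [Functor.comp_map] at this
  rw [RelMonad.map, h.bind_comm, RelMonad.map]
  simp only [Functor.map_comp, Category.assoc]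
  rw [← reassoc_of% this, h.unit_comm]

/-- The identity colax morphism, over identity functors. -/
def id (P : RelMonad F) : ColaxHom P P (𝟭 C) (𝟭 D) ⟨fun c => 𝟙 (F.obj c), by intros; simp⟩ where
  τ c := 𝟙 _
  bind_comm f := by simp
  unit_comm c := by simp

/-- The composite of colax morphisms, over the composite functors. -/
def comp (h : ColaxHom P Q G G' N) (k : ColaxHom Q R H H' M) :
    ColaxHom P R (G ⋙ H) (G' ⋙ H')
      ⟨fun c => M.app (G.obj c) ≫ H'.map (N.app c), by
        intro c d f
        have h1 := N.naturality f
        have h2 := M.naturality (G.map f)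
        simp only [Functor.comp_map] at h1 h2 ⊢
        rw [reassoc_of% h2, Category.assoc, ← H'.map_comp, ← H'.map_comp, h1]⟩ where
  τ c := H'.map (h.τ c) ≫ k.τ (G.obj c)
  bind_comm f := by
    simp only [Functor.comp_map, Category.assoc]
    rw [← H'.map_comp_assoc, h.bind_comm]
    simp only [Functor.map_comp, Category.assoc, k.bind_comm]
  unit_comm c := by
    simp only [Functor.comp_map, Category.assoc]
    rw [← H'.map_comp_assoc (G'.map _), ← H'.map_comp_assoc (N.app c), h.unit_comm, k.unit_comm]
    rfl

/-- Replacing the functors of a colax morphism along isomorphic ones. -/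
def transport (h : ColaxHom P Q G G' N) {G₂ : C ⥤ C'} {G₂' : D ⥤ D'}
    (N₂ : G₂ ⋙ F' ⟶ F ⋙ G₂') (a : G ≅ G₂) (b : G₂' ⟶ G')
    (w : ∀ c, N₂.app c ≫ b.app (F.obj c) = F'.map (a.inv.app c) ≫ N.app c) :
    ColaxHom P Q G₂ G₂' N₂ where
  τ c := b.app (P.obj c) ≫ h.τ c ≫ Q.map (a.hom.app c)
  bind_comm {c d} f := by
    have e : F'.map (a.hom.app c) ≫ N₂.app c ≫ b.app (F.obj c) = N.app c := by
      rw [w, ← F'.map_comp_assoc]; simp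
    rw [b.naturality_assoc]
    simp only [Category.assoc]
    rw [Q.map_bind, reassoc_of% (h.bind_comm f), Q.bind_map, b.naturality_assoc, reassoc_of% e]
    simp
  unit_comm c := by
    rw [b.naturality_assoc, reassoc_of% (w c), ← Category.assoc (G'.map _),
      ← Category.assoc (N.app c), h.unit_comm, Q.unit_map, ← F'.map_comp_assoc]
    simp

end ColaxHom

/-- A module over a relative monad `P`, with codomain `E`. -/
structure RelModule {C : Type u₁} [Category.{v₁} C] {D : Type u₂} [Category.{v₂} D]
    {F : C ⥤ D} (P : RelMonad F) (E : Type u₃) [Category.{v₃} E] where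
  obj : C → E
  bind : ∀ {X Y}, (F.obj X ⟶ P.obj Y) → (obj X ⟶ obj Y)
  bind_unit : ∀ X, bind (P.unit X) = 𝟙 (obj X)
  bind_bind : ∀ {X Y Z} (f : F.obj X ⟶ P.obj Y) (g : F.obj Y ⟶ P.obj Z),
    bind f ≫ bind g = bind (f ≫ P.bind g)

namespace RelModule

variable {C : Type u₁} [Category.{v₁} C] {D : Type u₂} [Category.{v₂} D] {F : C ⥤ D}
  {P : RelMonad F} {E : Type u₃} [Category.{v₃} E] {E' : Type u₄} [Category.{v₄} E']

/-- Morphisms of modules over the same relative monad. -/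
@[ext]
structure Hom (M N : RelModule P E) where
  app : ∀ X, M.obj X ⟶ N.obj X
  bind_comm : ∀ {X Y} (f : F.obj X ⟶ P.obj Y), M.bind f ≫ app Y = app X ≫ N.bind f

/-- The category of `P`-modules with codomain `E`. -/
instance : Category (RelModule P E) where
  Hom := Hom
  id M := ⟨fun X => 𝟙 _, by intros; simp⟩
  comp f g := ⟨fun X => f.app X ≫ g.app X, by
    intro X Y k
    rw [← Category.assoc, f.bind_comm, Category.assoc, g.bind_comm, Category.assoc]⟩
  id_comp f := by apply Hom.ext; funext; simp
  comp_id f := by apply Hom.ext; funext; simp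
  assoc f g h := by apply Hom.ext; funext; simp

/-- The functorial action of a module. -/
def map (M : RelModule P E) {X Y : C} (f : X ⟶ Y) : M.obj X ⟶ M.obj Y :=
  M.bind (F.map f ≫ P.unit Y)

theorem map_bind (M : RelModule P E) {X Y Z : C} (f : X ⟶ Y) (g : F.obj Y ⟶ P.obj Z) :
    M.map f ≫ M.bind g = M.bind (F.map f ≫ g) := by
  simp [map, bind_bind, RelMonad.unit_bind]

theorem bind_map (M : RelModule P E) {X Y Z : C} (f : F.obj X ⟶ P.obj Y) (g : Y ⟶ Z) :
    M.bind f ≫ M.map g = M.bind (f ≫ P.map g) := by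
  simp [map, bind_bind, RelMonad.map]

theorem map_id (M : RelModule P E) (X : C) : M.map (𝟙 X) = 𝟙 (M.obj X) := by
  simp [map, bind_unit]

theorem map_comp (M : RelModule P E) {X Y Z : C} (f : X ⟶ Y) (g : Y ⟶ Z) :
    M.map (f ≫ g) = M.map f ≫ M.map g := by
  simp [map, bind_bind, RelMonad.unit_bind]

theorem Hom.naturality {M N : RelModule P E} (h : M ⟶ N) {X Y : C} (f : X ⟶ Y) :
    M.map f ≫ h.app Y = h.app X ≫ N.map f := h.bind_comm _

/-- The tautological module of a relative monad. -/
def taut (P : RelMonad F) : RelModule P D where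
  obj := P.obj
  bind := P.bind
  bind_unit := P.bind_unit
  bind_bind := P.bind_bind

/-- Postcomposition of a module with a functor. -/
def postcomp (M : RelModule P E) (H : E ⥤ E') : RelModule P E' where
  obj X := H.obj (M.obj X)
  bind f := H.map (M.bind f)
  bind_unit X := by rw [M.bind_unit, H.map_id]
  bind_bind f g := by rw [← H.map_comp, M.bind_bind]

variable {C' : Type u₅} [Category.{v₅} C'] {D' : Type u₆} [Category.{v₆} D'] {F' : C' ⥤ D'}
  {Q : RelMonad F'} {G : C ⥤ C'} {G' : D ⥤ D'} {N : G ⋙ F' ⟶ F ⋙ G'}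

/-- The pullback of a `Q`-module along a colax morphism `P → Q`. -/
def pullback (h : ColaxHom P Q G G' N) (M : RelModule Q E) : RelModule P E where
  obj c := M.obj (G.obj c)
  bind {c d} f := M.bind (N.app c ≫ G'.map f ≫ h.τ d)
  bind_unit c := by rw [h.unit_comm, M.bind_unit]
  bind_bind f g := by
    rw [M.bind_bind, G'.map_comp]
    simp only [Category.assoc, h.bind_comm]

/-- The pullback of a module morphism along a colax morphism. -/
def pullbackMap (h : ColaxHom P Q G G' N) {M M' : RelModule Q E} (k : M ⟶ M') :
    pullback h M ⟶ pullback h M' :=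
  Hom.mk (fun c => k.app (G.obj c)) (fun _ => k.bind_comm _)

/-- The constant module with value the one-point preorder: the terminal module. -/
def one (P : RelMonad F) : RelModule P Preord.{u} where
  obj _ := Preord.of PUnit
  bind _ := 𝟙 _
  bind_unit _ := rfl
  bind_bind _ _ := Category.comp_id _

/-- The product of two modules with codomain preorders: products are taken pointwise and carry
the componentwise preorder. -/
def prod (M N : RelModule P Preord.{u}) : RelModule P Preord.{u} where
  obj X := Preord.of (M.obj X × N.obj X)
  bind f := Preord.ofHom ⟨fun x => (M.bind f x.1, N.bind f x.2),
    fun _ _ h => ⟨(M.bind f).hom.monotone h.1, (N.bind f).hom.monotone h.2⟩⟩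
  bind_unit X := Preord.ext fun x => by
    change (M.bind _ x.1, N.bind _ x.2) = x
    rw [M.bind_unit, N.bind_unit]
    rfl
  bind_bind f g := Preord.ext fun x => by
    change (_, _) = (M.bind _ x.1, N.bind _ x.2)
    rw [← M.bind_bind, ← N.bind_bind]
    rfl

end RelModule

/-! ### Families, the functor `Δ`, retyping -/

/-- The diagonal (equality) preorder on a set. -/
abbrev diagOrder (X : Type u) : Preorder X where
  le x y := x = y
  le_refl _ := rfl
  le_trans _ _ _ := Eq.trans

/-- The functor `Δ` from sets to preordered sets: each set carries its diagonal preorder. -/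
def Delta : Type u ⥤ Preord.{u} where
  obj X := @Preord.of X (diagOrder X)
  map {X Y} f := @Preord.ofHom X Y (diagOrder X) (diagOrder Y)
    (@OrderHom.mk X Y (diagOrder X) (diagOrder Y) f (fun _ _ h => congrArg f h))

/-- The functor `Δ^T` on `T`-indexed families. -/
def DeltaFam (T : Type u) : (T → Type u) ⥤ (T → Preord.{u}) where
  obj V t := Delta.obj (V t)
  map f t := Delta.map (f t)

/-- A family of maps out of a family of sets, as a morphism out of `Δ^T V`. -/
def DeltaFam.lift {T : Type u} {V : T → Type u} {A : T → Preord.{u}} (f : ∀ t, V t → A t) :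
    (DeltaFam T).obj V ⟶ A := fun t =>
  @Preord.ofHom (V t) (A t) (diagOrder (V t)) _
    (@OrderHom.mk (V t) (A t) (diagOrder (V t)) _ (f t) (fun _ _ h => le_of_eq (congrArg (f t) h)))

@[simp]
theorem DeltaFam.lift_apply {T : Type u} {V : T → Type u} {A : T → Preord.{u}}
    (f : ∀ t, V t → A t) (t : T) (x : V t) : DeltaFam.lift f t x = f t x := rfl

@[simp]
theorem DeltaFam.map_apply {T : Type u} {V W : T → Type u} (f : V ⟶ W) (t : T) (x : V t) :
    (DeltaFam T).map f t x = f t x := rfl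

theorem DeltaFam.hom_ext {T : Type u} {V : T → Type u} {A : T → Preord.{u}}
    {f g : (DeltaFam T).obj V ⟶ A} (h : ∀ t (x : V t), f t x = g t x) : f = g :=
  funext fun t => Preord.ext (h t)

/-- The retyping functor on families of sets, along `g : T → T'`.  It is the left Kan extension
along `g`: the fibre over `t'` is the coproduct of the `V s` over all `s` with `g s = t'`. -/
def retype {T T' : Type u} (g : T → T') : (T → Type u) ⥤ (T' → Type u) where
  obj V t' := Σ s : {s : T // g s = t'}, V s
  map f t' := ↾fun x => ⟨x.1, f x.1 x.2⟩

/-- The retyping functor on families of preordered sets, along `g : T → T'`: the left Kan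
extension along `g`, with coproducts of preordered sets (elements of different summands are
incomparable). -/
def retypePO {T T' : Type u} (g : T → T') : (T → Preord.{u}) ⥤ (T' → Preord.{u}) where
  obj A t' := Preord.of (Σ s : {s : T // g s = t'}, A s)
  map f t' := Preord.ofHom ⟨fun x => ⟨x.1, f x.1 x.2⟩, by
    rintro _ _ ⟨s, a, b, h⟩
    exact Sigma.LE.fiber _ _ _ ((f s).hom.monotone h)⟩

@[simp]
theorem retype_map_mk {T T' : Type u} (g : T → T') {V W : T → Type u} (f : V ⟶ W) (t' : T')
    (s : {s : T // g s = t'}) (x : V s) :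
    (retype g).map f t' (⟨s, x⟩ : Σ s : {s : T // g s = t'}, V s) = ⟨s, f s x⟩ := rfl

@[simp]
theorem retypePO_map_mk {T T' : Type u} (g : T → T') {A B : T → Preord.{u}} (f : A ⟶ B)
    (t' : T') (s : {s : T // g s = t'}) (x : A s) :
    (retypePO g).map f t' (⟨s, x⟩ : Σ s : {s : T // g s = t'}, A s) = ⟨s, f s x⟩ := rfl

/-- Retyping of families of sets is left adjoint to reindexing along `g`. -/
def retypeAdj {T T' : Type u} (g : T → T') : retype g ⊣ Pi.comap (fun _ : T' => Type u) g :=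
  Adjunction.mkOfHomEquiv
  { homEquiv := fun V W =>
      { toFun := fun f t => ↾fun x => f (g t) (⟨⟨t, rfl⟩, x⟩ : Σ s : {s // g s = g t}, V s)
        invFun := fun f t' => ↾fun x => x.1.2 ▸ f x.1 x.2
        left_inv := by
          intro f; funext t'; ext ⟨⟨s, rfl⟩, x⟩; rfl
        right_inv := by intro f; rfl }
    homEquiv_naturality_left_symm := by
      intro V V' W f h; funext t'; ext ⟨⟨s, rfl⟩, x⟩; rfl
    homEquiv_naturality_right := by
      intros; rfl }

/-- Retyping of families of preordered sets is left adjoint to reindexing along `g`. -/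
def retypePOAdj {T T' : Type u} (g : T → T') : retypePO g ⊣ Pi.comap (fun _ : T' => Preord.{u}) g :=
  Adjunction.mkOfHomEquiv
  { homEquiv := fun V W =>
      { toFun := fun f t => Preord.ofHom
          ⟨fun x => f (g t) (⟨⟨t, rfl⟩, x⟩ : Σ s : {s // g s = g t}, V s),
          fun a b h => (f (g t)).hom.monotone (Sigma.LE.fiber _ _ _ h)⟩
        invFun := fun f t' => Preord.ofHom ⟨fun x => x.1.2 ▸ f x.1 x.2, by
          rintro _ _ ⟨⟨s, rfl⟩, a, b, h⟩; exact (f s).hom.monotone h⟩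
        left_inv := by
          intro f; funext t'; refine Preord.ext ?_; rintro ⟨⟨s, rfl⟩, x⟩; rfl
        right_inv := by intro f; rfl }
    homEquiv_naturality_left_symm := by
      intro V V' W f h; funext t'; refine Preord.ext ?_; rintro ⟨⟨s, rfl⟩, x⟩; rfl
    homEquiv_naturality_right := by
      intros; rfl }

/-- The canonical transformation `Δ^{T'} ∘ retype g → retype g ∘ Δ^T`, which is the identity on
elements. -/
def retypeDelta {T T' : Type u} (g : T → T') :
    retype g ⋙ DeltaFam T' ⟶ DeltaFam T ⋙ retypePO g where
  app _ := DeltaFam.lift fun _ x => x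
  naturality _ _ _ := DeltaFam.hom_ext fun _ _ => rfl

@[simp]
theorem retypeDelta_app_apply {T T' : Type u} (g : T → T') (V : T → Type u) (t' : T')
    (x : Σ s : {s : T // g s = t'}, V s) : (retypeDelta g).app V t' x = x := rfl

/-- Retyping along the identity is isomorphic to the identity. -/
def retypeId (T : Type u) : 𝟭 (T → Type u) ≅ retype (fun t : T => t) where
  hom := { app := fun V t => ↾fun x => ⟨⟨t, rfl⟩, x⟩ }
  inv := { app := fun V t => ↾fun x => x.1.2 ▸ x.2
           naturality := by
            intro V W f
            funext t
            ext ⟨⟨_, rfl⟩, x⟩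
            rfl }
  hom_inv_id := rfl
  inv_hom_id := by
    ext V t ⟨⟨_, rfl⟩, x⟩
    rfl

/-- Retyping along the identity, on families of preordered sets. -/
def retypePOId (T : Type u) : retypePO (fun t : T => t) ⟶ 𝟭 (T → Preord.{u}) where
  app A t := Preord.ofHom ⟨fun x => x.1.2 ▸ x.2, by
    rintro _ _ ⟨⟨_, rfl⟩, a, b, h⟩
    exact h⟩
  naturality A B f := by
    funext t
    refine Preord.ext ?_
    rintro ⟨⟨_, rfl⟩, x⟩
    rfl

/-- Retyping in two steps is isomorphic to retyping along the composite. -/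
def retypeComp {T T' T'' : Type u} (g : T → T') (h : T' → T'') :
    retype g ⋙ retype h ≅ retype (fun t => h (g t)) where
  hom := { app := fun V t => ↾fun x => ⟨⟨x.2.1, (congrArg h x.2.1.2).trans x.1.2⟩, x.2.2⟩ }
  inv := { app := fun V t => ↾fun x => ⟨⟨g x.1, x.1.2⟩, ⟨⟨x.1, rfl⟩, x.2⟩⟩ }
  hom_inv_id := by
    ext V t x
    obtain ⟨⟨t', ht⟩, ⟨⟨s, hs⟩, x⟩⟩ := x
    change g s = t' at hs
    subst hs
    rfl
  inv_hom_id := rfl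

/-- Retyping in two steps and along the composite, on families of preordered sets. -/
def retypePOComp {T T' T'' : Type u} (g : T → T') (h : T' → T'') :
    retypePO (fun t => h (g t)) ⟶ retypePO g ⋙ retypePO h where
  app A t := Preord.ofHom ⟨fun x => ⟨⟨g x.1, x.1.2⟩, ⟨⟨x.1, rfl⟩, x.2⟩⟩, by
    rintro _ _ ⟨s, a, b, h⟩
    exact Sigma.LE.fiber _ _ _ (Sigma.LE.fiber _ _ _ h)⟩

/-- A relative monad on `Δ^T`, enriched: substitution is monotone for the pointwise preorder
on morphisms. -/
structure DeltaMonad (T : Type u) extends RelMonad (DeltaFam T) where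
  bind_mono : ∀ {V W : T → Type u} (f g : (DeltaFam T).obj V ⟶ obj W),
    (∀ t (x : V t), f t x ≤ g t x) → ∀ t (x : obj V t), bind f t x ≤ bind g t x

/-! ### PointedFam index sets -/

/-- The category of `T`-indexed families of objects of `C` with `n` marked elements of `T`; all
morphisms preserve the marking.  This is `C^T × T^n`, with `T^n` discrete. -/
abbrev PointedFam (C : Type u₁) [Category.{v₁} C] (T : Type u) (n : ℕ) : Type (max u₁ u) :=
  (T → C) × Discrete (Fin n → T)

section

variable {C : Type u₁} [Category.{v₁} C] {D : Type u₂} [Category.{v₂} D]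
  {C' : Type u₃} [Category.{v₃} C'] {D' : Type u₄} [Category.{v₄} D'] {T T' : Type u}

/-- The extension `F_n` of a functor between categories of families to marked families. -/
abbrev pointedFunctor (F : (T → C) ⥤ (T → D)) (n : ℕ) : PointedFam C T n ⥤ PointedFam D T n :=
  F.prod (𝟭 _)

/-- The relative monad `R_n` on `F_n` induced by a relative monad `R` on `F`. -/
def RelMonad.pointed {F : (T → C) ⥤ (T → D)} (R : RelMonad F) (n : ℕ) :
    RelMonad (pointedFunctor F n) where
  obj X := (R.obj X.1, X.2)
  unit X := (R.unit X.1, 𝟙 X.2)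
  bind f := (R.bind f.1, f.2)
  unit_bind f := Prod.ext (R.unit_bind f.1) (Subsingleton.elim _ _)
  bind_unit X := Prod.ext (R.bind_unit X.1) (Subsingleton.elim _ _)
  bind_bind f g := Prod.ext (R.bind_bind f.1 g.1) (Subsingleton.elim _ _)

/-- The extension `G(n)` of a functor to marked families, along `g` on the marked elements. -/
abbrev pointedAlong (g : T → T') (G : (T → C) ⥤ (T' → C)) (n : ℕ) :
    PointedFam C T n ⥤ PointedFam C T' n :=
  G.prod (Discrete.functor fun t => Discrete.mk (fun i => g (t i)))

/-- The colax morphism `P_n → Q_n` induced by a colax morphism `P → Q`. -/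
def ColaxHom.pointed {F : (T → C) ⥤ (T → D)} {F' : (T' → C) ⥤ (T' → D)}
    {P : RelMonad F} {Q : RelMonad F'} {G : (T → C) ⥤ (T' → C)} {G' : (T → D) ⥤ (T' → D)}
    {N : G ⋙ F' ⟶ F ⋙ G'} (h : ColaxHom P Q G G' N) (g : T → T') (n : ℕ) :
    ColaxHom (P.pointed n) (Q.pointed n) (pointedAlong g G n) (pointedAlong g G' n)
      { app := fun X => (N.app X.1, 𝟙 _)
        naturality := fun _ _ f => Prod.ext (N.naturality f.1) (Subsingleton.elim _ _) } where
  τ X := (h.τ X.1, 𝟙 _)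
  bind_comm f := Prod.ext (h.bind_comm f.1) (Subsingleton.elim _ _)
  unit_comm X := Prod.ext (h.unit_comm X.1) (Subsingleton.elim _ _)

/-- The functor which selects the component at the type chosen by `τ`. -/
def fibreFunctor (C : Type u₁) [Category.{v₁} C] {n : ℕ} (τ : (Fin n → T) → T) :
    PointedFam C T n ⥤ C where
  obj X := X.1 (τ X.2.as)
  map {X Y} f := f.1 (τ X.2.as) ≫ eqToHom (by rw [Discrete.eq_of_hom f.2])
  map_id X := by simp
  map_comp {X Y Z} f g := by
    obtain ⟨X, ⟨x⟩⟩ := X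
    obtain ⟨Y, ⟨y⟩⟩ := Y
    obtain ⟨Z, ⟨z⟩⟩ := Z
    obtain ⟨f, ⟨⟨h⟩⟩⟩ := f
    obtain ⟨g, ⟨⟨k⟩⟩⟩ := g
    dsimp only at h k
    subst h k
    simp

/-- The fibre module with respect to `τ`. -/
def RelModule.fibre {n : ℕ} {F : PointedFam C T n ⥤ PointedFam D T n} {P : RelMonad F}
    {E : Type u₃} [Category.{v₃} E]
    (M : RelModule P (PointedFam E T n)) (τ : (Fin n → T) → T) : RelModule P E :=
  M.postcomp (fibreFunctor E τ)

end

/-! ### Context extension -/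

/-- The context `D(u)`: it has one element of type `u`, and none of any other type. -/
structure FreshVar {T : Type u} (u t : T) : Type u where
  eq : u = t

/-- The context `V^{*u} = V + D(u)`. -/
abbrev extend {T : Type u} (V : T → Type u) (u : T) : T → Type u :=
  fun t => V t ⊕ FreshVar u t

/-- The inclusion `V → V^{*u}`. -/
def extendInl {T : Type u} (V : T → Type u) (u : T) : V ⟶ extend V u := fun _ => ↾Sum.inl

/-- The extension of a substitution `ΔV → PW` to contexts with one additional variable, which is
mapped to itself. -/
def DeltaMonad.shift {T : Type u} (P : DeltaMonad T) {V W : T → Type u} {u u' : T} (e : u = u')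
    (f : (DeltaFam T).obj V ⟶ P.obj W) : (DeltaFam T).obj (extend V u) ⟶ P.obj (extend W u') :=
  DeltaFam.lift fun t x => match x with
    | .inl x => P.map (extendInl W u') t (f t x)
    | .inr h => P.unit (extend W u') t (.inr ⟨e ▸ h.eq⟩)

theorem DeltaMonad.shift_unit {T : Type u} (P : DeltaMonad T) (V : T → Type u) {u : T}
    (e : u = u) : P.shift e (P.unit V) = P.unit (extend V u) := by
  refine DeltaFam.hom_ext ?_
  rintro t (x | ⟨h⟩)
  · exact congrArg (fun k : (DeltaFam T).obj V ⟶ P.obj (extend V u) => k t x)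
      (P.unit_map (extendInl V u))
  · rfl

theorem DeltaMonad.shift_bind {T : Type u} (P : DeltaMonad T) {V W X : T → Type u} {u u' u'' : T}
    (e : u = u') (e' : u' = u'') (f : (DeltaFam T).obj V ⟶ P.obj W)
    (g : (DeltaFam T).obj W ⟶ P.obj X) :
    P.shift e f ≫ P.bind (P.shift e' g) = P.shift (e.trans e') (f ≫ P.bind g) := by
  subst e e'
  refine DeltaFam.hom_ext ?_
  rintro t (x | ⟨h⟩)
  · have h1 : P.map (extendInl W u) ≫ P.bind (P.shift rfl g)
        = P.bind g ≫ P.map (extendInl X u) := by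
      rw [P.map_bind, P.bind_map]
      rfl
    exact congrArg (fun k : P.obj W ⟶ P.obj (extend X u) => k t (f t x)) h1
  · obtain ⟨rfl⟩ := h
    exact congrArg (fun k : (DeltaFam T).obj (extend W u) ⟶ P.obj (extend X u) =>
      k u (.inr ⟨rfl⟩)) (P.unit_bind (P.shift rfl g))

/-- The derived module with respect to `τ`: `M^τ (V, t) = M (V^{*τ(t)}, t)`. -/
def RelModule.deriv {T : Type u} {P : DeltaMonad T} {n : ℕ} {E : Type u₃} [Category.{v₃} E]
    (M : RelModule (P.pointed n) E) (τ : (Fin n → T) → T) : RelModule (P.pointed n) E where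
  obj X := M.obj (extend X.1 (τ X.2.as), X.2)
  bind {X Y} f := M.bind (X := (extend X.1 (τ X.2.as), X.2)) (Y := (extend Y.1 (τ Y.2.as), Y.2))
    (P.shift (congrArg τ (Discrete.eq_of_hom f.2)) f.1, f.2)
  bind_unit X := by
    rw [← M.bind_unit]
    exact congrArg M.bind (Prod.ext (P.shift_unit X.1 rfl) rfl)
  bind_bind f g := by
    rw [M.bind_bind]
    exact congrArg M.bind (Prod.ext (P.shift_bind
      (congrArg τ (Discrete.eq_of_hom f.2)) (congrArg τ (Discrete.eq_of_hom g.2)) f.1 g.1) rfl)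

/-! ### Signatures for types -/

/-- An algebraic signature: a family of natural numbers. -/
structure AlgSig where
  Op : Type u
  arity : Op → ℕ

/-- A representation of an algebraic signature in a set. -/
structure SRep (S : AlgSig.{u}) where
  carrier : Type u
  op : ∀ o : S.Op, (Fin (S.arity o) → carrier) → carrier

/-- Morphisms of representations of an algebraic signature. -/
@[ext]
structure SRep.Hom {S : AlgSig.{u}} (A B : SRep S) where
  map : A.carrier → B.carrier
  map_op : ∀ (o : S.Op) (a : Fin (S.arity o) → A.carrier),
    map (A.op o a) = B.op o (fun i => map (a i))

/-- The category of representations of an algebraic signature. -/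
instance (S : AlgSig.{u}) : Category (SRep S) where
  Hom := SRep.Hom
  id _ := ⟨fun a => a, fun _ _ => rfl⟩
  comp f g := ⟨fun a => g.map (f.map a), fun o a => by rw [f.map_op, g.map_op]⟩

/-- The set `S(n)` of terms over `S` with free variables among `n` variables. -/
inductive STerm (S : AlgSig.{u}) (n : ℕ) : Type u
  | var (m : Fin n) : STerm S n
  | op (o : S.Op) (a : Fin (S.arity o) → STerm S n) : STerm S n

/-- The canonical transformation denoted by `s ∈ S(n)`: it picks an element of `T`, for any
representation `T` of `S` with `n` marked elements. -/
def STerm.eval {S : AlgSig.{u}} {n : ℕ} (A : SRep S) :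
    STerm S n → (Fin n → A.carrier) → A.carrier
  | .var m, t => t m
  | .op o a, t => A.op o (fun i => (a i).eval A t)

/-- Naturality of the canonical transformations. -/
theorem STerm.map_eval {S : AlgSig.{u}} {n : ℕ} {A B : SRep S} (g : A ⟶ B) (s : STerm S n)
    (t : Fin n → A.carrier) : g.map (s.eval A t) = s.eval B (fun i => g.map (t i)) := by
  induction s with
  | var m => rfl
  | op o a ih => simp only [STerm.eval, g.map_op, ih]

/-! ### Relative `S`-monads -/

/-- A relative `S`-monad: a representation of `S` in a set `T`, and an (enriched) relative monad
on `Δ^T`. -/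
structure SMonad (S : AlgSig.{u}) where
  sorts : SRep S
  mon : DeltaMonad sorts.carrier

namespace SMonad

variable {S : AlgSig.{u}}

/-- The family of preordered sets of terms in context `V`. -/
abbrev obj (P : SMonad S) (V : P.sorts.carrier → Type u) : P.sorts.carrier → Preord.{u} :=
  P.mon.obj V

/-- A morphism of relative `S`-monads: a morphism `g` of representations of `S` and a colax
morphism of relative monads over the retyping functors of `g`. -/
structure Hom (P Q : SMonad S) where
  sort : P.sorts ⟶ Q.sorts
  colax : ColaxHom P.mon.toRelMonad Q.mon.toRelMonad (retype sort.map) (retypePO sort.map)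
    (retypeDelta sort.map)

/-- The identity morphism. -/
def Hom.id (P : SMonad S) : Hom P P where
  sort := 𝟙 P.sorts
  colax := (ColaxHom.id P.mon.toRelMonad).transport (retypeDelta fun t => t)
    (retypeId P.sorts.carrier) (retypePOId P.sorts.carrier) (fun _ => DeltaFam.hom_ext (by
      rintro t ⟨⟨_, rfl⟩, x⟩
      rfl))

/-- Composition: colax morphisms are composed, and retyping along the composite is identified with
retyping in two steps. -/
def Hom.comp {P Q R : SMonad S} (f : Hom P Q) (g : Hom Q R) : Hom P R where
  sort := f.sort ≫ g.sort
  colax := (f.colax.comp g.colax).transport (retypeDelta fun t => g.sort.map (f.sort.map t))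
    (retypeComp f.sort.map g.sort.map) (retypePOComp f.sort.map g.sort.map)
    (fun _ => DeltaFam.hom_ext (fun _ _ => rfl))

/-- The action of a morphism of `S`-monads on terms. -/
def Hom.app {P Q : SMonad S} (f : Hom P Q) (V : P.sorts.carrier → Type u)
    {s : P.sorts.carrier} {t : Q.sorts.carrier} (h : f.sort.map s = t) (x : P.obj V s) :
    Q.obj ((retype f.sort.map).obj V) t :=
  f.colax.τ V t (⟨⟨s, h⟩, x⟩ : Σ s : {s // f.sort.map s = t}, P.obj V s)

theorem Hom.id_app (P : SMonad S) (V : P.sorts.carrier → Type u) {s t : P.sorts.carrier}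
    (h : s = t) (x : P.obj V s) :
    (Hom.id P).app V h x = P.mon.map ((retypeId P.sorts.carrier).hom.app V) t (h ▸ x) := by
  subst h
  rfl

theorem Hom.comp_app {P Q R : SMonad S} (f : Hom P Q) (g : Hom Q R)
    (V : P.sorts.carrier → Type u) {s : P.sorts.carrier} {t : R.sorts.carrier}
    (h : g.sort.map (f.sort.map s) = t) (x : P.obj V s) :
    (f.comp g).app V h x = R.mon.map ((retypeComp f.sort.map g.sort.map).hom.app V) t
      (g.app _ h (f.app V rfl x)) := rfl

theorem Hom.app_map {P Q : SMonad S} (f : Hom P Q) {V W : P.sorts.carrier → Type u} (k : V ⟶ W)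
    {s : P.sorts.carrier} {t : Q.sorts.carrier} (h : f.sort.map s = t) (x : P.obj V s) :
    f.app W h (P.mon.map k s x) = Q.mon.map ((retype f.sort.map).map k) t (f.app V h x) :=
  congrArg (fun m : (retypePO f.sort.map).obj (P.obj V) ⟶
      Q.obj ((retype f.sort.map).obj W) =>
    m t (⟨⟨s, h⟩, x⟩ : Σ s : {s // f.sort.map s = t}, P.obj V s)) (f.colax.naturality k)

theorem Hom.ext_app {P Q : SMonad S} (g : P.sorts ⟶ Q.sorts)
    (c d : ColaxHom P.mon.toRelMonad Q.mon.toRelMonad (retype g.map) (retypePO g.map)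
      (retypeDelta g.map))
    (h : ∀ (V : P.sorts.carrier → Type u) (s : P.sorts.carrier) (x : P.obj V s),
      (Hom.mk g c).app V rfl x = (Hom.mk g d).app V rfl x) :
    Hom.mk g c = Hom.mk g d := by
  congr 1
  apply ColaxHom.ext
  funext V t
  refine Preord.ext ?_
  rintro ⟨⟨s, rfl⟩, x⟩
  exact h V s x

theorem map_map_apply (P : SMonad S) {V W X : P.sorts.carrier → Type u} (f : V ⟶ W)
    (g : W ⟶ X) (t : P.sorts.carrier) (x : P.obj V t) :
    P.mon.map g t (P.mon.map f t x) = P.mon.map (f ≫ g) t x := by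
  rw [P.mon.map_comp]
  rfl

/-- The category of relative `S`-monads. -/
instance : Category (SMonad S) where
  Hom := Hom
  id := Hom.id
  comp := Hom.comp
  id_comp {P Q} f := by
    refine Hom.ext_app f.sort _ _ fun V s x => ?_
    refine (Hom.comp_app _ _ _ _ _).trans ?_
    erw [Hom.id_app, Hom.app_map, map_map_apply]
    refine Eq.trans ?_ (congrArg (fun m : Q.obj _ ⟶ Q.obj _ => m _ _) (Q.mon.map_id _))
    rfl
  comp_id {P Q} f := by
    refine Hom.ext_app f.sort _ _ fun V s x => ?_
    refine (Hom.comp_app _ _ _ _ _).trans ?_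
    erw [Hom.id_app, map_map_apply]
    refine Eq.trans ?_ (congrArg (fun m : Q.obj _ ⟶ Q.obj _ => m _ _) (Q.mon.map_id _))
    rfl
  assoc {P Q R T} f g h := by
    refine Hom.ext_app _ _ _ fun V s x => ?_
    refine (Hom.comp_app (f.comp g) h _ _ _).trans (Eq.trans ?_ (Hom.comp_app f (g.comp h) _ _ _).symm)
    erw [Hom.comp_app, Hom.app_map, map_map_apply, Hom.comp_app, map_map_apply]
    rfl

end SMonad

/-! ### Signatures for terms -/

/-- The classic half-arities over `S` of degree `n`: the constant half-arity `*`, the fibres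
`[Θ_n]_τ` of the tautological module, the derivation `M^τ` of a classic half-arity, and products.
The transformations `τ` are canonical, i.e. given by elements of `S(n)`. -/
inductive HalfArity (S : AlgSig.{u}) (n : ℕ) : Type u
  | one : HalfArity S n
  | fibre (τ : STerm S n) : HalfArity S n
  | deriv (M : HalfArity S n) (τ : STerm S n) : HalfArity S n
  | prod (M N : HalfArity S n) : HalfArity S n

/-- The comparison of retyping and context extension. -/
def retypeExtend {T T' : Type u} (g : T → T') (V : T → Type u) {u : T} {u' : T'} (e : g u = u') :
    (retype g).obj (extend V u) ⟶ extend ((retype g).obj V) u' := fun _ =>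
  ↾fun x => match x with
    | ⟨s, .inl x⟩ => .inl ⟨s, x⟩
    | ⟨s, .inr h⟩ => .inr ⟨by rw [← e, h.eq, s.2]⟩

namespace SMonad

variable {S : AlgSig.{u}}

theorem Hom.app_unit {P Q : SMonad S} (f : Hom P Q) (V : P.sorts.carrier → Type u)
    {s : P.sorts.carrier} {t : Q.sorts.carrier} (h : f.sort.map s = t) (x : V s) :
    f.app V h (P.mon.unit V s x) = Q.mon.unit ((retype f.sort.map).obj V) t
      (⟨⟨s, h⟩, x⟩ : Σ s : {s // f.sort.map s = t}, V s) :=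
  congrArg (fun m : (DeltaFam Q.sorts.carrier).obj ((retype f.sort.map).obj V) ⟶
      Q.obj ((retype f.sort.map).obj V) =>
    m t (⟨⟨s, h⟩, x⟩ : Σ s : {s // f.sort.map s = t}, V s)) (f.colax.unit_comm V)

theorem map_unit_apply (P : SMonad S) {V W : P.sorts.carrier → Type u} (f : V ⟶ W)
    (t : P.sorts.carrier) (x : V t) :
    P.mon.map f t (P.mon.unit V t x) = P.mon.unit W t (f t x) :=
  congrArg (fun m : (DeltaFam P.sorts.carrier).obj V ⟶ P.obj W => m t x) (P.mon.unit_map f)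

theorem shift_retype {P Q : SMonad S} (f : Hom P Q) {V W : P.sorts.carrier → Type u}
    {u₁ u₂ : P.sorts.carrier} {w₁ w₂ : Q.sorts.carrier} (e : u₁ = u₂) (e' : w₁ = w₂)
    (h₁ : f.sort.map u₁ = w₁) (h₂ : f.sort.map u₂ = w₂)
    (k : (DeltaFam P.sorts.carrier).obj V ⟶ P.obj W) :
    ((retypeDelta f.sort.map).app (extend V u₁) ≫ (retypePO f.sort.map).map (P.mon.shift e k) ≫
        f.colax.τ (extend W u₂)) ≫ Q.mon.map (retypeExtend f.sort.map W h₂) =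
      (DeltaFam Q.sorts.carrier).map (retypeExtend f.sort.map V h₁) ≫
        Q.mon.shift e' ((retypeDelta f.sort.map).app V ≫ (retypePO f.sort.map).map k ≫
          f.colax.τ W) := by
  subst e h₁
  subst h₂
  refine DeltaFam.hom_ext ?_
  rintro t ⟨⟨s, rfl⟩, x | ⟨h⟩⟩
  · change Q.mon.map _ _ (f.app _ rfl (P.mon.map _ _ (k s x))) =
      Q.mon.map _ _ (f.app _ rfl (k s x))
    rw [Hom.app_map, map_map_apply]
    rfl
  · exact (congrArg (Q.mon.map (retypeExtend f.sort.map W rfl) (f.sort.map s))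
      (Hom.app_unit f (extend W u₁) rfl (.inr h))).trans
        (map_unit_apply Q (retypeExtend f.sort.map W rfl) (f.sort.map s) _)

end SMonad

namespace HalfArity

variable {S : AlgSig.{u}} {n : ℕ}

/-- The `P_n`-module which a classic half-arity of degree `n` associates to a relative `S`-monad
`P`. -/
def module : HalfArity S n → (P : SMonad S) → RelModule (P.mon.pointed n) Preord.{u}
  | .one, _ => RelModule.one _
  | .fibre τ, P => (RelModule.taut (P.mon.pointed n)).fibre (τ.eval P.sorts)
  | .deriv M τ, P => (M.module P).deriv (τ.eval P.sorts)
  | .prod M N, P => (M.module P).prod (N.module P)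

/-- The action of a classic half-arity on morphisms of relative `S`-monads. -/
def map : (M : HalfArity S n) → {P Q : SMonad S} → (f : P ⟶ Q) →
    (M.module P ⟶ RelModule.pullback (f.colax.pointed f.sort.map n) (M.module Q))
  | .one, _, _, _ => RelModule.Hom.mk (fun _ => 𝟙 _) (fun _ => rfl)
  | .fibre τ, P, Q, f => RelModule.Hom.mk
      (fun X => Preord.ofHom ⟨fun x => f.app X.1 (STerm.map_eval f.sort τ X.2.as) x,
        fun _ _ h => (f.colax.τ X.1 _).hom.monotone (Sigma.LE.fiber _ _ _ h)⟩)
      (by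
        rintro ⟨V, ⟨t⟩⟩ ⟨W, ⟨t'⟩⟩ ⟨k, ⟨⟨h⟩⟩⟩
        change t = t' at h
        subst h
        refine Preord.ext fun x => ?_
        have := congrArg (fun m : (retypePO f.sort.map).obj (P.obj V) ⟶
          Q.obj ((retype f.sort.map).obj W) => m _ (⟨⟨τ.eval P.sorts t,
            STerm.map_eval f.sort τ t⟩, x⟩ : Σ s : {s // f.sort.map s = _}, P.obj V s))
              (f.colax.bind_comm k)
        exact this)
  | .deriv M τ, P, Q, f => RelModule.Hom.mk
      (fun X => (M.map f).app (extend X.1 (τ.eval P.sorts X.2.as), X.2) ≫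
        (M.module Q).map (Y := (extend ((retype f.sort.map).obj X.1)
            (τ.eval Q.sorts fun i => f.sort.map (X.2.as i)),
              Discrete.mk fun i => f.sort.map (X.2.as i)))
          (retypeExtend f.sort.map X.1 (STerm.map_eval f.sort τ X.2.as), 𝟙 _))
      (by
        intro X Y k
        have h := (M.map f).bind_comm (X := (extend X.1 (τ.eval P.sorts X.2.as), X.2))
          (Y := (extend Y.1 (τ.eval P.sorts Y.2.as), Y.2))
          (P.mon.shift (congrArg _ (Discrete.eq_of_hom k.2)) k.1, k.2)
        refine (Category.assoc _ _ _).symm.trans ((congrArg (· ≫ _) h).trans ?_)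
        refine (Category.assoc _ _ _).trans (Eq.trans ?_ (Category.assoc _ _ _).symm)
        refine congrArg (_ ≫ ·) ?_
        refine ((M.module Q).bind_map _ _).trans (Eq.trans ?_ ((M.module Q).map_bind _ _).symm)
        refine congrArg (M.module Q).bind (Prod.ext ?_ (Subsingleton.elim _ _))
        have e : X.2.as = Y.2.as := Discrete.eq_of_hom k.2
        exact SMonad.shift_retype f (congrArg _ e) (by rw [e]) (STerm.map_eval f.sort τ _)
          (STerm.map_eval f.sort τ _) k.1)
  | .prod M N, P, Q, f => RelModule.Hom.mk
      (fun X => Preord.ofHom ⟨fun x => ((M.map f).app X x.1, (N.map f).app X x.2),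
        fun _ _ h => ⟨((M.map f).app X).hom.monotone h.1, ((N.map f).app X).hom.monotone h.2⟩⟩)
      (fun {X Y} k => Preord.ext fun x => Prod.ext
        (congrArg (fun m : (M.module P).obj X ⟶ _ => m x.1) ((M.map f).bind_comm k))
        (congrArg (fun m : (N.module P).obj X ⟶ _ => m x.2) ((N.map f).bind_comm k)))

end HalfArity

theorem RelModule.pullback_map {C : Type u₁} [Category.{v₁} C] {D : Type u₂} [Category.{v₂} D]
    {F : C ⥤ D} {P : RelMonad F} {E : Type u₃} [Category.{v₃} E] {C' : Type u₅} [Category.{v₅} C']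
    {D' : Type u₆} [Category.{v₆} D'] {F' : C' ⥤ D'} {Q : RelMonad F'} {G : C ⥤ C'} {G' : D ⥤ D'}
    {N : G ⋙ F' ⟶ F ⋙ G'} (h : ColaxHom P Q G G' N) (M : RelModule Q E) {X Y : C} (k : X ⟶ Y) :
    (RelModule.pullback h M).map k = M.map (G.map k) := by
  have := N.naturality k
  simp only [Functor.comp_map] at this
  simp only [RelModule.map, RelModule.pullback, Functor.map_comp, Category.assoc]
  rw [← reassoc_of% this, h.unit_comm]

theorem DeltaMonad.shift_map {T : Type u} (P : DeltaMonad T) {V W : T → Type u} (u : T)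
    (f : V ⟶ W) (e : u = u) :
    P.shift e ((DeltaFam T).map f ≫ P.unit W) =
      (DeltaFam T).map (fun t => ↾Sum.map (f t) id : extend V u ⟶ extend W u) ≫
        P.unit (extend W u) := by
  refine DeltaFam.hom_ext ?_
  rintro t (x | h)
  · exact congrArg (fun k : (DeltaFam T).obj W ⟶ P.obj (extend W u) => k t (f t x))
      (P.unit_map (extendInl W u))
  · rfl

theorem RelModule.deriv_map {T : Type u} {P : DeltaMonad T} {n : ℕ} {E : Type u₃}
    [Category.{v₃} E] (M : RelModule (P.pointed n) E) (τ : (Fin n → T) → T) {V W : T → Type u}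
    (t : Discrete (Fin n → T)) (f : V ⟶ W) :
    (M.deriv τ).map (X := (V, t)) (Y := (W, t)) (f, 𝟙 t) =
      M.map (X := (extend V (τ t.as), t)) (Y := (extend W (τ t.as), t))
        (fun s => ↾Sum.map (f s) id, 𝟙 t) :=
  congrArg M.bind (Prod.ext (P.shift_map (τ t.as) f rfl) rfl)

namespace HalfArity

variable {S : AlgSig.{u}} {n : ℕ}

/-- A classic half-arity preserves identities. -/
theorem map_id (M : HalfArity S n) (P : SMonad S) (V : P.sorts.carrier → Type u)
    (t : Discrete (Fin n → P.sorts.carrier)) :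
    (M.map (𝟙 P)).app (V, t) = (M.module P).map (X := (V, t))
      (Y := ((retype fun s : P.sorts.carrier => s).obj V, t)) ((retypeId P.sorts.carrier).hom.app V, 𝟙 t) := by
  induction M generalizing V with
  | one => rfl
  | fibre τ =>
    refine Preord.ext fun x => ?_
    refine (SMonad.Hom.id_app P V (rfl : τ.eval P.sorts t.as = _) x).trans ?_
    rfl
  | deriv M τ ih =>
    refine Eq.trans ?_ ((M.module P).deriv_map (τ.eval P.sorts) t _).symm
    change (M.map (𝟙 P)).app _ ≫ _ = _
    rw [ih]
    refine ((M.module P).map_comp _ _).symm.trans ?_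
    refine congrArg (M.module P).map (Prod.ext ?_ (Subsingleton.elim _ _))
    funext s
    ext (x | h) <;> rfl
  | prod M N ihM ihN =>
    refine Preord.ext fun x => Prod.ext ?_ ?_
    · exact congrArg (fun m : (M.module P).obj (V, t) ⟶ _ => m x.1) (ihM V)
    · exact congrArg (fun m : (N.module P).obj (V, t) ⟶ _ => m x.2) (ihN V)

/-- A classic half-arity preserves composition. -/
theorem map_comp (M : HalfArity S n) {P Q R : SMonad S} (f : P ⟶ Q) (g : Q ⟶ R)
    (V : P.sorts.carrier → Type u) (t : Discrete (Fin n → P.sorts.carrier)) :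
    (M.map (f ≫ g)).app (V, t) =
      (M.map f).app (V, t) ≫
        (M.map g).app ((retype f.sort.map).obj V, Discrete.mk fun i => f.sort.map (t.as i)) ≫
        (M.module R).map
          (X := ((retype g.sort.map).obj ((retype f.sort.map).obj V),
            Discrete.mk fun i => g.sort.map (f.sort.map (t.as i))))
          (Y := ((retype fun s => g.sort.map (f.sort.map s)).obj V,
            Discrete.mk fun i => g.sort.map (f.sort.map (t.as i))))
          ((retypeComp f.sort.map g.sort.map).hom.app V, 𝟙 _) := by
  induction M generalizing V with
  | one => rfl
  | fibre τ =>
    refine Preord.ext fun x => ?_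
    refine (SMonad.Hom.comp_app f g V _ x).trans ?_
    have key : ∀ {b : Q.sorts.carrier} {c : R.sorts.carrier}
        (h : f.sort.map (τ.eval P.sorts t.as) = b) (h' : g.sort.map b = c),
        g.app _ ((congrArg g.sort.map h).trans h') (f.app V rfl x) = g.app _ h' (f.app V h x) := by
      rintro _ _ rfl rfl
      rfl
    exact congrArg (R.mon.map ((retypeComp f.sort.map g.sort.map).hom.app V) _)
      (key (STerm.map_eval f.sort τ t.as) (STerm.map_eval g.sort τ _))
  | deriv M τ ih =>
    change (M.map (f ≫ g)).app _ ≫ _ = ((M.map f).app _ ≫ _) ≫ ((M.map g).app _ ≫ _) ≫ _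
    rw [ih]
    erw [RelModule.deriv_map, Category.assoc, Category.assoc, Category.assoc, Category.assoc,
      reassoc_of% RelModule.Hom.naturality (M.map g), RelModule.pullback_map]
    erw [← RelModule.map_comp, ← RelModule.map_comp, ← RelModule.map_comp]
    refine congrArg (fun k => (M.map f).app _ ≫ (M.map g).app _ ≫ (M.module R).map k)
      (Prod.ext ?_ (Subsingleton.elim _ _))
    funext s
    ext x
    obtain ⟨s, ⟨s', x | h⟩⟩ := x <;> rfl
  | prod M N ihM ihN =>
    refine Preord.ext fun x => Prod.ext ?_ ?_
    · exact congrArg (fun m : (M.module P).obj (V, t) ⟶ _ => m x.1) (ihM V)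
    · exact congrArg (fun m : (N.module P).obj (V, t) ⟶ _ => m x.2) (ihN V)

end HalfArity

/-- A classic arity over `S`: a degree `n`, a classic half-arity of degree `n` as domain, and a
codomain of the form `[Θ_n]_τ` with `τ` canonical. -/
structure Arity (S : AlgSig.{u}) where
  degree : ℕ
  dom : HalfArity S degree
  target : STerm S degree

/-- The codomain of a classic arity. -/
abbrev Arity.cod {S : AlgSig.{u}} (α : Arity S) : HalfArity S α.degree := .fibre α.target

/-- A term-signature over `S`: a family of classic arities over `S`. -/
structure TermSig (S : AlgSig.{u}) where
  Con : Type u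
  arity : Con → Arity S

/-- A 1-signature: a signature for types and a term-signature over it. -/
structure OneSig where
  types : AlgSig.{u}
  terms : TermSig types

/-! ### Representations of 1-signatures -/

/-- A representation of a 1-signature: a relative `S`-monad together with, for each arity `α`, a
morphism of modules `dom α → cod α`. -/
structure RepDelta (Sg : OneSig.{u}) where
  smon : SMonad Sg.types
  con : ∀ i : Sg.terms.Con,
    (Sg.terms.arity i).dom.module smon ⟶ (Sg.terms.arity i).cod.module smon

namespace RepDelta

variable {Sg : OneSig.{u}}

/-- The set of types of a representation. -/
abbrev Ty (R : RepDelta Sg) : Type u := R.smon.sorts.carrier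

/-- The preordered set of terms of type `t` in context `V`. -/
abbrev Tm (R : RepDelta Sg) (V : R.Ty → Type u) (t : R.Ty) : Preord.{u} := R.smon.mon.obj V t

/-- The preordered set of arguments of a constructor with domain `M`, in context `V`, for the
instances `ts` of the type variables. -/
abbrev Args (R : RepDelta Sg) {n : ℕ} (M : HalfArity Sg.types n) (V : R.Ty → Type u)
    (ts : Fin n → R.Ty) : Preord.{u} :=
  (M.module R.smon).obj (V, Discrete.mk ts)

/-- The variable `x`, as a term. -/
def var (R : RepDelta Sg) {V : R.Ty → Type u} {t : R.Ty} (x : V t) : R.Tm V t :=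
  R.smon.mon.unit V t x

/-- The type of the terms built by the constructor `i`. -/
abbrev conTy (R : RepDelta Sg) (i : Sg.terms.Con) (ts : Fin (Sg.terms.arity i).degree → R.Ty) : R.Ty :=
  (Sg.terms.arity i).target.eval R.smon.sorts ts

/-- The constructor `i`, applied to arguments. -/
def app (R : RepDelta Sg) (i : Sg.terms.Con) {V : R.Ty → Type u}
    {ts : Fin (Sg.terms.arity i).degree → R.Ty} (a : R.Args (Sg.terms.arity i).dom V ts) :
    R.Tm V (R.conTy i ts) :=
  (R.con i).app (V, Discrete.mk ts) a

theorem paste_squares {C : Type u₁} [Category.{v₁} C] {A₁ A₂ A₃ A₄ B₁ B₂ B₃ B₄ : C}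
    {c₁ : A₁ ⟶ B₁} {c₂ : A₂ ⟶ B₂} {c₃ : A₃ ⟶ B₃} {c₄ : A₄ ⟶ B₄}
    {a₁ : A₁ ⟶ A₂} {a₂ : A₂ ⟶ A₃} {a₃ : A₃ ⟶ A₄} {b₁ : B₁ ⟶ B₂} {b₂ : B₂ ⟶ B₃} {b₃ : B₃ ⟶ B₄}
    (h₁ : c₁ ≫ b₁ = a₁ ≫ c₂) (h₂ : c₂ ≫ b₂ = a₂ ≫ c₃) (h₃ : c₃ ≫ b₃ = a₃ ≫ c₄) :
    c₁ ≫ b₁ ≫ b₂ ≫ b₃ = (a₁ ≫ a₂ ≫ a₃) ≫ c₄ := by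
  rw [reassoc_of% h₁, reassoc_of% h₂, h₃]
  simp only [Category.assoc]

/-- Morphisms of representations: morphisms of relative `S`-monads which commute with the
representations of all arities. -/
@[ext]
structure Hom (P R : RepDelta Sg) where
  hom : P.smon ⟶ R.smon
  comm : ∀ i : Sg.terms.Con,
    P.con i ≫ (Sg.terms.arity i).cod.map hom =
      (Sg.terms.arity i).dom.map hom ≫
        RelModule.pullbackMap (hom.colax.pointed hom.sort.map _) (R.con i)

/-- The category `Rep^Δ(S, Σ)` of representations of a 1-signature. -/
instance : Category (RepDelta Sg) where
  Hom := Hom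
  id P := ⟨𝟙 P.smon, fun i => RelModule.Hom.ext (funext fun X => by
    obtain ⟨V, t⟩ := X
    change (P.con i).app (V, t) ≫ (HalfArity.map _ (𝟙 P.smon)).app (V, t) =
      (HalfArity.map _ (𝟙 P.smon)).app (V, t) ≫ (P.con i).app _
    rw [HalfArity.map_id, HalfArity.map_id]
    exact (RelModule.Hom.naturality (P.con i) _).symm)⟩
  comp {P Q R} f g := ⟨f.hom ≫ g.hom, fun i => RelModule.Hom.ext (funext fun X => by
    obtain ⟨V, t⟩ := X
    change (P.con i).app (V, t) ≫ (HalfArity.map _ (f.hom ≫ g.hom)).app (V, t) =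
      (HalfArity.map _ (f.hom ≫ g.hom)).app (V, t) ≫ (R.con i).app _
    have hf := congrArg (fun k => RelModule.Hom.app k (V, t)) (f.comm i)
    have hg := congrArg (fun k => RelModule.Hom.app k ((retype f.hom.sort.map).obj V,
      Discrete.mk fun j => f.hom.sort.map (t.as j))) (g.comm i)
    rw [HalfArity.map_comp, HalfArity.map_comp]
    change (P.con i).app (V, t) ≫ (HalfArity.map _ f.hom).app (V, t) =
      (HalfArity.map _ f.hom).app (V, t) ≫ (Q.con i).app _ at hf
    change (Q.con i).app _ ≫ (HalfArity.map _ g.hom).app _ =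
      (HalfArity.map _ g.hom).app _ ≫ (R.con i).app _ at hg
    have hn := RelModule.Hom.naturality (R.con i)
          (X := ((retype g.hom.sort.map).obj ((retype f.hom.sort.map).obj V),
            Discrete.mk fun i => g.hom.sort.map (f.hom.sort.map (t.as i))))
          (Y := ((retype fun s => g.hom.sort.map (f.hom.sort.map s)).obj V,
            Discrete.mk fun i => g.hom.sort.map (f.hom.sort.map (t.as i))))
          ((retypeComp f.hom.sort.map g.hom.sort.map).hom.app V, 𝟙 _)
    exact paste_squares hf hg hn.symm)⟩
  id_comp f := Hom.ext (Category.id_comp f.hom)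
  comp_id f := Hom.ext (Category.comp_id f.hom)
  assoc f g h := Hom.ext (Category.assoc f.hom g.hom h.hom)

/-! ### Freely generated terms -/

/-- `R.All p M V ts a` says that all the terms occurring in the list of arguments `a` (which may
live in extensions of the context `V`) satisfy `p`. -/
def All (R : RepDelta Sg) (p : ∀ (V : R.Ty → Type u) (t : R.Ty), R.Tm V t → Prop) {n : ℕ} :
    ∀ (M : HalfArity Sg.types n) (V : R.Ty → Type u) (ts : Fin n → R.Ty), R.Args M V ts → Prop
  | .one, _, _, _ => True
  | .fibre τ, V, ts, a => p V (τ.eval R.smon.sorts ts) a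
  | .deriv M τ, V, ts, a => R.All p M (extend V (τ.eval R.smon.sorts ts)) ts a
  | .prod M N, V, ts, a => R.All p M V ts a.1 ∧ R.All p N V ts a.2

/-- The map which builds a term in context `V` from a variable, or from a constructor, instances of
its type variables, and arguments. -/
def build (R : RepDelta Sg) (V : R.Ty → Type u) :
    (Σ t, V t) ⊕ (Σ (i : Sg.terms.Con) (ts : Fin (Sg.terms.arity i).degree → R.Ty),
      R.Args (Sg.terms.arity i).dom V ts) → Σ t, R.Tm V t
  | .inl ⟨t, x⟩ => ⟨t, R.var x⟩
  | .inr ⟨i, ts, a⟩ => ⟨R.conTy i ts, R.app i a⟩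

/-- The terms of `R` are freely generated from the variables by the constructors: every term is
built in exactly one way from a variable or a constructor with arguments, and terms are well-founded,
i.e. satisfy structural induction. -/
structure FreelyGenerated (R : RepDelta Sg) : Prop where
  bijective : ∀ V : R.Ty → Type u, Function.Bijective (R.build V)
  induction : ∀ p : ∀ (V : R.Ty → Type u) (t : R.Ty), R.Tm V t → Prop,
    (∀ V t (x : V t), p V t (R.var x)) →
    (∀ i V ts (a : R.Args (Sg.terms.arity i).dom V ts),
      R.All p (Sg.terms.arity i).dom V ts a → p V (R.conTy i ts) (R.app i a)) →
    ∀ V t (x : R.Tm V t), p V t x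

end RepDelta

-- Over the initial representation of `S`, let the terms be the least family containing the
-- variables and closed under the constructors, with equality as preorder. The order then costs
-- nothing: a map out of an equality preorder is monotone, and arguments built from discrete
-- preorders are again discrete. What remains is initiality of a syntax with typed binding.
--
-- The monad structure is simultaneous substitution. Renaming, substitution and interpretation in a
-- representation are all instances of one recursion, `TermKit.traverse`, which carries an
-- assignment of values to variables and extends it under each binder. The monad laws come from one
-- fusion principle, `TermKit.traverse_traverse` (two traversals whose assignments compose are a
-- single traversal), together with `Term.subst_var`. Constructors are module morphisms because
-- substitution commutes with them by definition.
--
-- Given a representation `R`, initiality of the types provides a unique `g` on types. Terms are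
-- interpreted in `R` by recursion, sending each variable to the corresponding variable of `R` in
-- the retyped context. This is a colax morphism because both sides of the substitution square are
-- interpretations of the same term: one by `eval_subst` (fusion), the other by `bind_eval`
-- (induction, using that the constructors of `R` are module morphisms). Conversely, the unit law
-- fixes any morphism on variables and the arity laws fix it on constructors, so induction gives
-- uniqueness (`hom_app_eq_eval`).
--
-- The encoding has two peculiarities. Argument lists are defined by recursion on the half-arity, so
-- the inductive type of terms uses a family indexed by positions instead, and `pack` and `unpack`
-- translate. A context that varied as an index would raise the universe, so it is a parameter and
-- only the list of bound types varies; `reroot` moves a term between presentations of one extended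
-- context.

universe w w'

/-! ### Argument lists with entries in a family of types -/

namespace HalfArity

variable {S : AlgSig.{u}} {n : ℕ}

/-- The argument lists of shape `M` in context `V`, with entries in the family `X`. -/
def Args (A : SRep S) (X : (A.carrier → Type u) → A.carrier → Type w) :
    HalfArity S n → (A.carrier → Type u) → (Fin n → A.carrier) → Type w
  | .one, _, _ => PUnit
  | .fibre τ, V, ts => X V (τ.eval A ts)
  | .deriv M τ, V, ts => M.Args A X (extend V (τ.eval A ts)) ts
  | .prod M N, V, ts => M.Args A X V ts × N.Args A X V ts

/-- All the entries of an argument list satisfy `p`. -/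
def ArgsAll {A : SRep S} {X : (A.carrier → Type u) → A.carrier → Type w}
    (p : ∀ V t, X V t → Prop) :
    ∀ (M : HalfArity S n) (V : A.carrier → Type u) (ts : Fin n → A.carrier),
      M.Args A X V ts → Prop
  | .one, _, _, _ => True
  | .fibre τ, V, ts, a => p V (τ.eval A ts) a
  | .deriv M τ, V, ts, a => M.ArgsAll p (extend V (τ.eval A ts)) ts a
  | .prod M N, V, ts, a => M.ArgsAll p V ts a.1 ∧ N.ArgsAll p V ts a.2

theorem argsAll_of_forall {A : SRep S} {X : (A.carrier → Type u) → A.carrier → Type w}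
    {p : ∀ V t, X V t → Prop} (h : ∀ V t x, p V t x) (M : HalfArity S n) :
    ∀ (V : A.carrier → Type u) (ts : Fin n → A.carrier) (a : M.Args A X V ts),
      M.ArgsAll p V ts a := by
  induction M with
  | one => exact fun _ _ _ => trivial
  | fibre τ => exact fun _ _ _ => h _ _ _
  | deriv M τ ih => exact fun _ _ _ => ih _ _ _
  | prod M N ihM ihN => exact fun _ _ _ => ⟨ihM _ _ _, ihN _ _ _⟩

/-- Entrywise application of a family of maps. -/
def argsMap {A : SRep S} {X : (A.carrier → Type u) → A.carrier → Type w}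
    {Y : (A.carrier → Type u) → A.carrier → Type w'} (f : ∀ V t, X V t → Y V t) :
    ∀ (M : HalfArity S n) (V : A.carrier → Type u) (ts : Fin n → A.carrier),
      M.Args A X V ts → M.Args A Y V ts
  | .one, _, _, _ => PUnit.unit
  | .fibre _, _, _, a => f _ _ a
  | .deriv M _, _, _, a => M.argsMap f _ _ a
  | .prod M N, _, _, a => (M.argsMap f _ _ a.1, N.argsMap f _ _ a.2)

/-! ### Argument lists as families over positions -/

/-- The positions of the entries in an argument list. -/
def Pos : HalfArity S n → Type u
  | .one => PEmpty
  | .fibre _ => PUnit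
  | .deriv M _ => M.Pos
  | .prod M N => M.Pos ⊕ N.Pos

/-- The type of the entry at a position. -/
def posTy (A : SRep S) (ts : Fin n → A.carrier) : ∀ M : HalfArity S n, M.Pos → A.carrier
  | .fibre τ, _ => τ.eval A ts
  | .deriv M _, p => M.posTy A ts p
  | .prod M _, .inl p => M.posTy A ts p
  | .prod _ N, .inr p => N.posTy A ts p

/-- The list of types of the variables in scope at a position, on top of `Γ`. -/
def posList (A : SRep S) (ts : Fin n → A.carrier) :
    ∀ M : HalfArity S n, M.Pos → List A.carrier → List A.carrier
  | .fibre _, _, Γ => Γ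
  | .deriv M τ, p, Γ => M.posList A ts p (τ.eval A ts :: Γ)
  | .prod M _, .inl p, Γ => M.posList A ts p Γ
  | .prod _ N, .inr p, Γ => N.posList A ts p Γ

/-- The context at a position of an argument list in context `V`. -/
def posCtx (A : SRep S) (ts : Fin n → A.carrier) :
    ∀ M : HalfArity S n, M.Pos → (A.carrier → Type u) → A.carrier → Type u
  | .fibre _, _, V => V
  | .deriv M τ, p, V => M.posCtx A ts p (extend V (τ.eval A ts))
  | .prod M _, .inl p, V => M.posCtx A ts p V
  | .prod _ N, .inr p, V => N.posCtx A ts p V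

/-- An argument list from its entries. -/
def pack {A : SRep S} {X : (A.carrier → Type u) → A.carrier → Type w} {ts : Fin n → A.carrier} :
    ∀ (M : HalfArity S n) (V : A.carrier → Type u),
      (∀ p, X (M.posCtx A ts p V) (M.posTy A ts p)) → M.Args A X V ts
  | .one, _, _ => PUnit.unit
  | .fibre _, _, b => b PUnit.unit
  | .deriv M _, _, b => M.pack _ b
  | .prod M N, V, b => (M.pack V fun p => b (.inl p), N.pack V fun p => b (.inr p))

/-- The entries of an argument list. -/
def unpack {A : SRep S} {X : (A.carrier → Type u) → A.carrier → Type w} {ts : Fin n → A.carrier} :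
    ∀ (M : HalfArity S n) (V : A.carrier → Type u), M.Args A X V ts →
      ∀ p, X (M.posCtx A ts p V) (M.posTy A ts p)
  | .fibre _, _, a, _ => a
  | .deriv M _, _, a, p => M.unpack _ a p
  | .prod M _, V, a, .inl p => M.unpack V a.1 p
  | .prod _ N, V, a, .inr p => N.unpack V a.2 p

variable {A : SRep S} {X : (A.carrier → Type u) → A.carrier → Type w} {ts : Fin n → A.carrier}

theorem pack_unpack (M : HalfArity S n) :
    ∀ (V : A.carrier → Type u) (a : M.Args A X V ts), M.pack V (M.unpack V a) = a := by
  induction M with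
  | one => exact fun _ _ => rfl
  | fibre τ => exact fun _ _ => rfl
  | deriv M τ ih => exact fun _ _ => ih _ _
  | prod M N ihM ihN => exact fun _ _ => Prod.ext (ihM _ _) (ihN _ _)

theorem unpack_pack (M : HalfArity S n) :
    ∀ (V : A.carrier → Type u) (b : ∀ p, X (M.posCtx A ts p V) (M.posTy A ts p)) (p : M.Pos),
      M.unpack V (M.pack V b) p = b p := by
  induction M with
  | one => exact fun _ _ p => p.elim
  | fibre τ => exact fun _ _ _ => rfl
  | deriv M τ ih => exact fun _ _ _ => ih _ _ _
  | prod M N ihM ihN =>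
    rintro V b (p | p)
    · exact ihM V _ p
    · exact ihN V _ p

theorem argsAll_of_unpack {q : ∀ V t, X V t → Prop} (M : HalfArity S n) :
    ∀ (V : A.carrier → Type u) (a : M.Args A X V ts), (∀ p, q _ _ (M.unpack V a p)) →
      M.ArgsAll q V ts a := by
  induction M with
  | one => exact fun _ _ _ => trivial
  | fibre τ => exact fun _ _ h => h PUnit.unit
  | deriv M τ ih => exact fun _ _ h => ih _ _ h
  | prod M N ihM ihN =>
    exact fun _ _ h => ⟨ihM _ _ fun p => h (.inl p), ihN _ _ fun p => h (.inr p)⟩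

/-- Recursion on terms works position by position; this turns its result into an entrywise map, as
needed for `Term.fold_con`. -/
theorem pack_map {Y : (A.carrier → Type u) → A.carrier → Type w'} (f : ∀ V t, X V t → Y V t)
    (M : HalfArity S n) :
    ∀ (V : A.carrier → Type u) (a : M.Args A X V ts),
      M.pack V (fun p => f _ _ (M.unpack V a p)) = M.argsMap f V ts a := by
  induction M with
  | one => exact fun _ _ => rfl
  | fibre τ => exact fun _ _ => rfl
  | deriv M τ ih => exact fun _ _ => ih _ _
  | prod M N ihM ihN => exact fun _ _ => Prod.ext (ihM _ _) (ihN _ _)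

end HalfArity

/-! ### Freely generated terms -/

/-- The context `V`, extended by variables of the types in a list. -/
def extendList {T : Type u} (V : T → Type u) : List T → T → Type u
  | [] => V
  | u :: Γ => extend (extendList V Γ) u

/-- Reconciles the two descriptions of the scope at a position: a list over a fixed base, and an
iterated extension. The list `Γ` and the context `U` are general because a derivation extends both.
-/
theorem HalfArity.extendList_posList {S : AlgSig.{u}} {n : ℕ} {A : SRep S} {ts : Fin n → A.carrier}
    (M : HalfArity S n) {V : A.carrier → Type u} :
    ∀ {Γ : List A.carrier} {U : A.carrier → Type u}, extendList V Γ = U →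
      ∀ p : M.Pos, extendList V (M.posList A ts p Γ) = M.posCtx A ts p U := by
  induction M with
  | one => exact fun _ p => p.elim
  | fibre τ => exact fun h _ => h
  | deriv M τ ih => exact fun h p => ih (Γ := τ.eval A ts :: _) (congrArg (extend · (τ.eval A ts)) h) p
  | prod M N ihM ihN =>
    rintro Γ U h (p | p)
    · exact ihM h p
    · exact ihN h p

theorem HalfArity.extendList_posList_nil {S : AlgSig.{u}} {n : ℕ} {A : SRep S}
    {ts : Fin n → A.carrier} (M : HalfArity S n) (V : A.carrier → Type u) (p : M.Pos) :
    extendList V (M.posList A ts p []) = extendList (M.posCtx A ts p V) [] :=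
  M.extendList_posList rfl p

/-- The terms over a term-signature, in the context `V` extended by a list of bound variables.
Listing the bound variables separately keeps the terms in the universe of `V`. -/
inductive ScopedTerm {S : AlgSig.{u}} (Sg : TermSig S) (A : SRep S) (V : A.carrier → Type u) :
    List A.carrier → A.carrier → Type u
  | var {Γ : List A.carrier} {t : A.carrier} (x : extendList V Γ t) : ScopedTerm Sg A V Γ t
  | con {Γ : List A.carrier} (i : Sg.Con) (ts : Fin (Sg.arity i).degree → A.carrier)
      (a : ∀ p : (Sg.arity i).dom.Pos, ScopedTerm Sg A V ((Sg.arity i).dom.posList A ts p Γ)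
        ((Sg.arity i).dom.posTy A ts p)) : ScopedTerm Sg A V Γ ((Sg.arity i).target.eval A ts)

namespace ScopedTerm

variable {S : AlgSig.{u}} {Sg : TermSig S} {A : SRep S} {V W U : A.carrier → Type u}

/-- Terms only depend on the extended context. -/
def reroot : ∀ {Γ : List A.carrier} {t : A.carrier}, ScopedTerm Sg A V Γ t →
    ∀ {Δ : List A.carrier}, extendList V Γ = extendList W Δ → ScopedTerm Sg A W Δ t
  | _, t, .var x, _, h => .var (cast (congrFun h t) x)
  | _, _, .con i ts a, _, h => .con i ts fun p => (a p).reroot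
      (((Sg.arity i).dom.extendList_posList h p).trans
        ((Sg.arity i).dom.extendList_posList rfl p).symm)

theorem reroot_reroot {Γ : List A.carrier} {t : A.carrier} (x : ScopedTerm Sg A V Γ t) :
    ∀ {Δ Ε : List A.carrier} (h : extendList V Γ = extendList W Δ)
      (h' : extendList W Δ = extendList U Ε), (x.reroot h).reroot h' = x.reroot (h.trans h') := by
  induction x with
  | var x => intro Δ Ε h h'; simp [reroot]
  | con i ts a ih =>
    intro Δ Ε h h'
    exact congrArg (ScopedTerm.con i ts) (funext fun p => ih p _ _)

theorem reroot_self {Γ : List A.carrier} {t : A.carrier} (x : ScopedTerm Sg A V Γ t)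
    (h : extendList V Γ = extendList V Γ) : x.reroot h = x := by
  induction x with
  | var x => rfl
  | con i ts a ih => exact congrArg (ScopedTerm.con i ts) (funext fun p => ih p _)

/-- Structural recursion over terms, into families indexed by contexts and types. -/
def fold {X : (A.carrier → Type u) → A.carrier → Type w} (v : ∀ V t, V t → X V t)
    (c : ∀ (i : Sg.Con) (V : A.carrier → Type u) (ts : Fin (Sg.arity i).degree → A.carrier),
      (Sg.arity i).dom.Args A X V ts → X V ((Sg.arity i).target.eval A ts)) :
    ∀ {Γ : List A.carrier} {t : A.carrier}, ScopedTerm Sg A V Γ t →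
      ∀ {U : A.carrier → Type u}, extendList V Γ = U → X U t
  -- The target context is an arbitrary `U` with an equation, because the context that `pack`
  -- expects at a position equals the extended list only propositionally.
  | _, t, .var x, U, h => v U t (cast (congrFun h t) x)
  | _, _, .con i ts a, U, h => c i U ts ((Sg.arity i).dom.pack U fun p =>
      (a p).fold v c ((Sg.arity i).dom.extendList_posList h p))

theorem fold_reroot {X : (A.carrier → Type u) → A.carrier → Type w} (v : ∀ V t, V t → X V t)
    (c : ∀ (i : Sg.Con) (V : A.carrier → Type u) (ts : Fin (Sg.arity i).degree → A.carrier),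
      (Sg.arity i).dom.Args A X V ts → X V ((Sg.arity i).target.eval A ts))
    {Γ : List A.carrier} {t : A.carrier} (x : ScopedTerm Sg A V Γ t) :
    ∀ {Δ : List A.carrier} (h : extendList V Γ = extendList W Δ) {U : A.carrier → Type u}
      (h' : extendList W Δ = U), (x.reroot h).fold v c h' = x.fold v c (h.trans h') := by
  induction x with
  | var x => intro Δ h U h'; simp [reroot, fold]
  | con i ts a ih =>
    intro Δ h U h'
    simp only [reroot, fold]
    refine congrArg (fun b => c i U ts ((Sg.arity i).dom.pack U b)) (funext fun p => ?_)
    exact ih p _ _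

end ScopedTerm

/-- The terms over a term-signature in context `V`, with types in a representation `A` of the
signature for types. -/
def Term {S : AlgSig.{u}} (Sg : TermSig S) (A : SRep S) (V : A.carrier → Type u)
    (t : A.carrier) : Type u :=
  ScopedTerm Sg A V [] t

namespace Term

variable {S : AlgSig.{u}} {Sg : TermSig S} {A : SRep S}

/-- A variable, as a term. -/
def var {V : A.carrier → Type u} {t : A.carrier} (x : V t) : Term Sg A V t :=
  ScopedTerm.var (Γ := []) x

/-- A constructor applied to arguments. -/
def con (i : Sg.Con) {V : A.carrier → Type u} {ts : Fin (Sg.arity i).degree → A.carrier}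
    (a : (Sg.arity i).dom.Args A (Term Sg A) V ts) :
    Term Sg A V ((Sg.arity i).target.eval A ts) :=
  ScopedTerm.con (Γ := []) i ts fun p => ((Sg.arity i).dom.unpack V a p).reroot
    ((Sg.arity i).dom.extendList_posList_nil V p).symm

/-- Structural recursion over terms. -/
def fold {X : (A.carrier → Type u) → A.carrier → Type w} (v : ∀ V t, V t → X V t)
    (c : ∀ (i : Sg.Con) (V : A.carrier → Type u) (ts : Fin (Sg.arity i).degree → A.carrier),
      (Sg.arity i).dom.Args A X V ts → X V ((Sg.arity i).target.eval A ts))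
    (V : A.carrier → Type u) (t : A.carrier) (x : Term Sg A V t) : X V t :=
  ScopedTerm.fold v c x rfl

/-- The computation rule at constructors. It needs an argument because `con` reroots its arguments
to the base context; `fold` does not see this, by `ScopedTerm.fold_reroot`. -/
theorem fold_con {X : (A.carrier → Type u) → A.carrier → Type w} (v : ∀ V t, V t → X V t)
    (c : ∀ (i : Sg.Con) (V : A.carrier → Type u) (ts : Fin (Sg.arity i).degree → A.carrier),
      (Sg.arity i).dom.Args A X V ts → X V ((Sg.arity i).target.eval A ts))
    (i : Sg.Con) {V : A.carrier → Type u} {ts : Fin (Sg.arity i).degree → A.carrier}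
    (a : (Sg.arity i).dom.Args A (Term Sg A) V ts) :
    fold v c V _ (con i a) = c i V ts ((Sg.arity i).dom.argsMap (fold v c) V ts a) := by
  refine congrArg (c i V ts) (Eq.trans ?_ ((Sg.arity i).dom.pack_map (fold v c) V a))
  refine congrArg ((Sg.arity i).dom.pack V) (funext fun p => ?_)
  exact ScopedTerm.fold_reroot v c _ _ _

/-- The arguments of a constructor, from terms with separate bound variables. -/
def ofScoped (i : Sg.Con) {V : A.carrier → Type u} {ts : Fin (Sg.arity i).degree → A.carrier}
    (a : ∀ p : (Sg.arity i).dom.Pos, ScopedTerm Sg A V ((Sg.arity i).dom.posList A ts p [])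
      ((Sg.arity i).dom.posTy A ts p)) : (Sg.arity i).dom.Args A (Term Sg A) V ts :=
  (Sg.arity i).dom.pack V fun p => (a p).reroot ((Sg.arity i).dom.extendList_posList_nil V p)

theorem con_ofScoped (i : Sg.Con) {V : A.carrier → Type u}
    {ts : Fin (Sg.arity i).degree → A.carrier}
    (a : ∀ p : (Sg.arity i).dom.Pos, ScopedTerm Sg A V ((Sg.arity i).dom.posList A ts p [])
      ((Sg.arity i).dom.posTy A ts p)) : con i (ofScoped i a) = ScopedTerm.con i ts a := by
  refine congrArg (ScopedTerm.con (Γ := []) i ts) (funext fun p => ?_)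
  refine (congrArg (ScopedTerm.reroot · _) ((Sg.arity i).dom.unpack_pack V _ p)).trans ?_
  exact (ScopedTerm.reroot_reroot _ _ _).trans (ScopedTerm.reroot_self _ _)

/-- The predicate concerns terms without bound variables in their index, so the induction runs over
all ways of absorbing the bound variables into the context. -/
theorem scoped_induction {q : ∀ (V : A.carrier → Type u) (t : A.carrier), Term Sg A V t → Prop}
    (hv : ∀ V t (x : V t), q V t (var x))
    (hc : ∀ (i : Sg.Con) V ts (a : (Sg.arity i).dom.Args A (Term Sg A) V ts),
      (Sg.arity i).dom.ArgsAll q V ts a → q V _ (con i a))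
    {V : A.carrier → Type u} {Γ : List A.carrier} {t : A.carrier} (x : ScopedTerm Sg A V Γ t) :
    ∀ {W : A.carrier → Type u} (h : extendList V Γ = extendList W []), q W t (x.reroot h) := by
  induction x with
  | var x => exact fun h => hv _ _ _
  | con i ts a ih =>
    intro W h
    refine (congrArg (q W _) (con_ofScoped i _)).mp (hc _ _ _ _ ?_)
    refine (Sg.arity i).dom.argsAll_of_unpack _ _ fun p => ?_
    refine (congrArg (q _ _) (((Sg.arity i).dom.unpack_pack W _ p).trans
      (ScopedTerm.reroot_reroot _ _ _))).mpr (ih p _)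

/-- Structural induction over terms, in all contexts simultaneously. -/
theorem induction {q : ∀ (V : A.carrier → Type u) (t : A.carrier), Term Sg A V t → Prop}
    (hv : ∀ V t (x : V t), q V t (var x))
    (hc : ∀ (i : Sg.Con) V ts (a : (Sg.arity i).dom.Args A (Term Sg A) V ts),
      (Sg.arity i).dom.ArgsAll q V ts a → q V _ (con i a))
    (V : A.carrier → Type u) (t : A.carrier) (x : Term Sg A V t) : q V t x :=
  (congrArg (q V t) (ScopedTerm.reroot_self x rfl)).mp (scoped_induction hv hc x rfl)

/-- A term is a variable, or a constructor applied to arguments. -/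
def dest {V : A.carrier → Type u} : (Σ t, Term Sg A V t) →
    (Σ t, V t) ⊕ (Σ (i : Sg.Con) (ts : Fin (Sg.arity i).degree → A.carrier),
      (Sg.arity i).dom.Args A (Term Sg A) V ts)
  | ⟨t, ScopedTerm.var x⟩ => .inl ⟨t, x⟩
  | ⟨_, ScopedTerm.con i ts a⟩ => .inr ⟨i, ts, ofScoped i a⟩

/-- Rerooting out of the base context and back is the identity, so `dest` recovers the constructor,
the types and the arguments. This gives uniqueness of the decomposition of a term. -/
theorem dest_con (i : Sg.Con) {V : A.carrier → Type u}
    {ts : Fin (Sg.arity i).degree → A.carrier}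
    (a : (Sg.arity i).dom.Args A (Term Sg A) V ts) : dest ⟨_, con i a⟩ = .inr ⟨i, ts, a⟩ := by
  refine congrArg (fun b : (Sg.arity i).dom.Args A (Term Sg A) V ts =>
    (Sum.inr ⟨i, ts, b⟩ : (Σ t, V t) ⊕ (Σ (i : Sg.Con)
      (ts : Fin (Sg.arity i).degree → A.carrier), (Sg.arity i).dom.Args A (Term Sg A) V ts))) ?_
  refine Eq.trans ?_ ((Sg.arity i).dom.pack_unpack V a)
  refine congrArg ((Sg.arity i).dom.pack V) (funext fun p => ?_)
  exact (ScopedTerm.reroot_reroot _ _ _).trans (ScopedTerm.reroot_self _ _)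

theorem exists_of_sigma {V : A.carrier → Type u} (x : Σ t, Term Sg A V t) :
    (∃ t, ∃ y : V t, x = ⟨t, var y⟩) ∨
      ∃ (i : Sg.Con) (ts : Fin (Sg.arity i).degree → A.carrier)
        (a : (Sg.arity i).dom.Args A (Term Sg A) V ts), x = ⟨_, con i a⟩ := by
  obtain ⟨t, x⟩ := x
  cases x with
  | var x => exact .inl ⟨t, x, rfl⟩
  | con i ts a => exact .inr ⟨i, ts, ofScoped i a, by rw [con_ofScoped]⟩

end Term

/-! ### Traversals of terms -/

/-- Families of sets indexed by contexts and types, with an operation for each constructor. -/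
structure TermAlg {S : AlgSig.{u}} (Sg : TermSig S) (B : SRep S) where
  obj : (B.carrier → Type u) → B.carrier → Type u
  con : ∀ (i : Sg.Con) (W : B.carrier → Type u) (ts : Fin (Sg.arity i).degree → B.carrier),
    (Sg.arity i).dom.Args B obj W ts → obj W ((Sg.arity i).target.eval B ts)

/-- Values for variables, which can be weakened, and interpreted in the algebra `Y`. -/
structure TermKit {S : AlgSig.{u}} {Sg : TermSig S} {B : SRep S} (Y : TermAlg Sg B) where
  val : (B.carrier → Type u) → B.carrier → Type u
  weaken : ∀ {W : B.carrier → Type u} {u t : B.carrier}, val W t → val (extend W u) t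
  fresh : ∀ {W : B.carrier → Type u} {u t : B.carrier}, FreshVar u t → val (extend W u) t
  quote : ∀ {W : B.carrier → Type u} {t : B.carrier}, val W t → Y.obj W t

namespace TermKit

variable {S : AlgSig.{u}} {Sg : TermSig S} {A B : SRep S} {Y : TermAlg Sg B}

/-- Assignments of values to variables, over a morphism of the representations of types. -/
abbrev Env (k : TermKit Y) (g : A ⟶ B) (V : A.carrier → Type u) (W : B.carrier → Type u) :
    Type u :=
  ∀ s, V s → k.val W (g.map s)

/-- The extension of an assignment under a binder. -/
def up (k : TermKit Y) {g : A ⟶ B} {V : A.carrier → Type u} {W : B.carrier → Type u}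
    {u : A.carrier} {u' : B.carrier} (e : g.map u = u') (ρ : k.Env g V W) :
    k.Env g (extend V u) (extend W u')
  | s, .inl x => k.weaken (ρ s x)
  | _, .inr h => k.fresh ⟨e.symm.trans (congrArg g.map h.eq)⟩

/-- Traversal of an argument list, given the traversal of its entries. -/
def traverseArgs (k : TermKit Y) (g : A ⟶ B) {X : (A.carrier → Type u) → A.carrier → Type w}
    (φ : ∀ V s, X V s → ∀ W, k.Env g V W → Y.obj W (g.map s)) {n : ℕ} :
    ∀ (M : HalfArity S n) (V : A.carrier → Type u) (ts : Fin n → A.carrier), M.Args A X V ts →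
      ∀ W, k.Env g V W → M.Args B Y.obj W fun j => g.map (ts j)
  | .one, _, _, _, _, _ => PUnit.unit
  | .fibre τ, _, ts, a, W, ρ => cast (congrArg (Y.obj W) (STerm.map_eval g τ ts)) (φ _ _ a W ρ)
  | .deriv M τ, _, ts, a, _, ρ =>
      k.traverseArgs g φ M _ ts a _ (k.up (STerm.map_eval g τ ts) ρ)
  | .prod M N, _, ts, a, W, ρ =>
      (k.traverseArgs g φ M _ ts a.1 W ρ, k.traverseArgs g φ N _ ts a.2 W ρ)

/-- The interpretation of a term in an algebra, given values for its variables. -/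
def traverse (k : TermKit Y) (g : A ⟶ B) :
    ∀ (V : A.carrier → Type u) (s : A.carrier), Term Sg A V s → ∀ W, k.Env g V W →
      Y.obj W (g.map s) :=
  -- The recursion produces functions of the assignment, since the assignment changes under binders.
  -- Quantifying over `W` puts this family in a larger universe than the terms.
  Term.fold (X := fun V s => ∀ W, k.Env g V W → Y.obj W (g.map s))
    (fun _ s x _ ρ => k.quote (ρ s x))
    -- The constructor yields type `τ(g ∘ ts)` where `g(τ(ts))` is expected; the two are equal only
    -- by naturality of `τ`.
    (fun i V ts a W ρ => cast (congrArg (Y.obj W) (STerm.map_eval g (Sg.arity i).target ts).symm)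
      (Y.con i W _ (k.traverseArgs g (fun _ _ x => x) (Sg.arity i).dom V ts a W ρ)))

theorem traverseArgs_argsMap (k : TermKit Y) (g : A ⟶ B)
    {X : (A.carrier → Type u) → A.carrier → Type w}
    {X' : (A.carrier → Type u) → A.carrier → Type w'} (f : ∀ V s, X V s → X' V s)
    (φ : ∀ V s, X' V s → ∀ W, k.Env g V W → Y.obj W (g.map s)) {n : ℕ} (M : HalfArity S n) :
    ∀ (V : A.carrier → Type u) (ts : Fin n → A.carrier) (a : M.Args A X V ts) (W) (ρ : k.Env g V W),
      k.traverseArgs g φ M V ts (M.argsMap f V ts a) W ρ =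
        k.traverseArgs g (fun V s x => φ V s (f V s x)) M V ts a W ρ := by
  induction M with
  | one => exact fun _ _ _ _ _ => rfl
  | fibre τ => exact fun _ _ _ _ _ => rfl
  | deriv M τ ih => exact fun _ _ _ _ _ => ih _ _ _ _ _
  | prod M N ihM ihN => exact fun _ _ _ _ _ => Prod.ext (ihM _ _ _ _ _) (ihN _ _ _ _ _)

theorem traverse_con (k : TermKit Y) (g : A ⟶ B) (i : Sg.Con) {V : A.carrier → Type u}
    {ts : Fin (Sg.arity i).degree → A.carrier} (a : (Sg.arity i).dom.Args A (Term Sg A) V ts)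
    (W : B.carrier → Type u) (ρ : k.Env g V W) :
    k.traverse g V _ (Term.con i a) W ρ =
      cast (congrArg (Y.obj W) (STerm.map_eval g (Sg.arity i).target ts).symm)
        (Y.con i W _ (k.traverseArgs g (k.traverse g) (Sg.arity i).dom V ts a W ρ)) := by
  refine (congrFun (congrFun (Term.fold_con _ _ i a) W) ρ).trans ?_
  exact congrArg (fun b => cast _ (Y.con i W _ b)) (k.traverseArgs_argsMap g _ _ _ _ _ _ _ _)

end TermKit

/-- The terms, as an algebra. -/
def termAlg {S : AlgSig.{u}} (Sg : TermSig S) (A : SRep S) : TermAlg Sg A where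
  obj := Term Sg A
  con i _ _ a := Term.con i a

namespace TermKit

variable {S : AlgSig.{u}} {Sg : TermSig S} {A B : SRep S} {Y : TermAlg Sg B}

/-! ### Fusion of traversals -/

section Fusion

variable (k : TermKit (termAlg Sg A)) (l m : TermKit Y) (g : A ⟶ B)
  (rel : ∀ {V V' : A.carrier → Type u} {W : B.carrier → Type u},
    k.Env (𝟙 A) V V' → l.Env g V' W → m.Env g V W → Prop)
  (hup : ∀ {V V' : A.carrier → Type u} {W : B.carrier → Type u} (ρ : k.Env (𝟙 A) V V')
    (σ : l.Env g V' W) (θ : m.Env g V W) (u : A.carrier) (u' : B.carrier) (e : g.map u = u'),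
    rel ρ σ θ → rel (k.up (u := u) (u' := u) rfl ρ) (l.up e σ) (m.up e θ))

-- The induction step of fusion, over the shape of the arguments: `hup` carries the relation between
-- the three assignments under each derivation.
include hup in
theorem traverseArgs_traverseArgs {n : ℕ} (M : HalfArity S n) :
    ∀ (V : A.carrier → Type u) (ts : Fin n → A.carrier) (a : M.Args A (Term Sg A) V ts)
      (_ : M.ArgsAll (fun V s x => ∀ V' W (ρ : k.Env (𝟙 A) V V') (σ : l.Env g V' W)
        (θ : m.Env g V W), rel ρ σ θ →
          l.traverse g V' s (k.traverse (𝟙 A) V s x V' ρ) W σ = m.traverse g V s x W θ) V ts a)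
      (V' W) (ρ : k.Env (𝟙 A) V V') (σ : l.Env g V' W) (θ : m.Env g V W), rel ρ σ θ →
      l.traverseArgs g (l.traverse g) M V' ts
        (k.traverseArgs (𝟙 A) (k.traverse (𝟙 A)) M V ts a V' ρ) W σ =
        m.traverseArgs g (m.traverse g) M V ts a W θ := by
  induction M with
  | one => exact fun _ _ _ _ _ _ _ _ _ _ => rfl
  | fibre τ => exact fun _ _ _ ih _ _ _ _ _ h => congrArg (cast _) (ih _ _ _ _ _ h)
  | deriv M τ ihM => exact fun _ _ _ ih _ _ _ _ _ h => ihM _ _ _ ih _ _ _ _ _ (hup _ _ _ _ _ _ h)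
  | prod M N ihM ihN =>
    exact fun _ _ _ ih _ _ _ _ _ h =>
      Prod.ext (ihM _ _ _ ih.1 _ _ _ _ _ h) (ihN _ _ _ ih.2 _ _ _ _ _ h)

include hup in
/-- Two traversals, one after the other, are a single traversal. -/
theorem traverse_traverse
    (hvar : ∀ {V V' : A.carrier → Type u} {W : B.carrier → Type u} (ρ : k.Env (𝟙 A) V V')
      (σ : l.Env g V' W) (θ : m.Env g V W), rel ρ σ θ → ∀ s (x : V s),
      l.traverse g V' s (k.quote (ρ s x)) W σ = m.quote (θ s x))
    (V : A.carrier → Type u) (s : A.carrier) (x : Term Sg A V s) :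
    ∀ V' W (ρ : k.Env (𝟙 A) V V') (σ : l.Env g V' W) (θ : m.Env g V W), rel ρ σ θ →
      l.traverse g V' s (k.traverse (𝟙 A) V s x V' ρ) W σ = m.traverse g V s x W θ := by
  induction V, s, x using Term.induction with
  | hv V s x => exact fun _ _ _ _ _ h => hvar _ _ _ h s x
  | hc i V ts a ih =>
    intro V' W ρ σ θ h
    rw [traverse_con m]
    refine (congrArg (fun y => l.traverse g V' _ y W σ) (traverse_con k (𝟙 A) i a V' ρ)).trans ?_
    refine (traverse_con l g i _ W σ).trans ?_
    exact congrArg (fun b => cast _ (Y.con i W _ b))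
      (traverseArgs_traverseArgs k l m g rel hup _ V ts a ih V' W ρ σ θ h)

end Fusion

end TermKit

/-! ### Renaming and substitution -/

/-- The kit for renaming: the values are variables. -/
def renameKit {S : AlgSig.{u}} (Sg : TermSig S) (A : SRep S) : TermKit (termAlg Sg A) where
  val W := W
  weaken x := .inl x
  fresh h := .inr h
  quote x := Term.var x

namespace Term

variable {S : AlgSig.{u}} {Sg : TermSig S} {A : SRep S}

/-- Renaming of variables. -/
def rename {V W : A.carrier → Type u} (ρ : ∀ t, V t → W t) {t : A.carrier} (x : Term Sg A V t) :
    Term Sg A W t :=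
  (renameKit Sg A).traverse (𝟙 A) V t x W ρ

end Term

/-- The kit for substitution: the values are terms. -/
def substKit {S : AlgSig.{u}} (Sg : TermSig S) (A : SRep S) : TermKit (termAlg Sg A) where
  val := Term Sg A
  weaken x := x.rename fun _ => .inl
  fresh h := Term.var (.inr h)
  quote x := x

namespace Term

variable {S : AlgSig.{u}} {Sg : TermSig S} {A : SRep S}

/-- Substitution of terms for variables. -/
def subst {V W : A.carrier → Type u} (ρ : ∀ t, V t → Term Sg A W t) {t : A.carrier}
    (x : Term Sg A V t) : Term Sg A W t :=
  (substKit Sg A).traverse (𝟙 A) V t x W ρ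

theorem subst_con (i : Sg.Con) {V W : A.carrier → Type u}
    {ts : Fin (Sg.arity i).degree → A.carrier} (a : (Sg.arity i).dom.Args A (Term Sg A) V ts)
    (ρ : ∀ t, V t → Term Sg A W t) :
    (con i a).subst ρ = con i ((substKit Sg A).traverseArgs (𝟙 A) ((substKit Sg A).traverse (𝟙 A))
      (Sg.arity i).dom V ts a W ρ) :=
  -- Over the identity on types the cast in `traverse_con` is between definitionally equal types and
  -- disappears.
  TermKit.traverse_con (substKit Sg A) (𝟙 A) i a W ρ

/-- Fusion, with `rel` saying that the third assignment is the composite of the first two. Only the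
step under a binder differs among the four composition laws: here and in `subst_rename` it is
immediate; `rename_subst` uses `rename_rename`, and `subst_subst` uses both mixed laws. -/
theorem rename_rename {V W U : A.carrier → Type u} (ρ : ∀ t, V t → W t) (σ : ∀ t, W t → U t)
    {t : A.carrier} (x : Term Sg A V t) :
    (x.rename ρ).rename σ = x.rename fun t y => σ t (ρ t y) := by
  refine TermKit.traverse_traverse (renameKit Sg A) (renameKit Sg A) (renameKit Sg A) (𝟙 A)
    (fun {V V' W} ρ σ θ => ∀ s (y : V s), θ s y = σ s (ρ s y)) ?_ ?_ V t x W U ρ σ _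
    fun _ _ => rfl
  · rintro V V' W ρ σ θ u _ rfl h s (y | y)
    · exact congrArg Sum.inl (h s y)
    · rfl
  · intro V V' W ρ σ θ h s y
    exact congrArg Term.var (h s y).symm

theorem subst_rename {V W U : A.carrier → Type u} (ρ : ∀ t, V t → W t)
    (σ : ∀ t, W t → Term Sg A U t) {t : A.carrier} (x : Term Sg A V t) :
    (x.rename ρ).subst σ = x.subst fun t y => σ t (ρ t y) := by
  refine TermKit.traverse_traverse (renameKit Sg A) (substKit Sg A) (substKit Sg A) (𝟙 A)
    (fun {V V' W} ρ σ θ => ∀ s (y : V s), θ s y = σ s (ρ s y)) ?_ ?_ V t x W U ρ σ _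
    fun _ _ => rfl
  · rintro V V' W ρ σ θ u _ rfl h s (y | y)
    · exact congrArg (Term.rename _) (h s y)
    · rfl
  · intro V V' W ρ σ θ h s y
    exact (h s y).symm

theorem rename_subst {V W U : A.carrier → Type u} (ρ : ∀ t, V t → Term Sg A W t)
    (σ : ∀ t, W t → U t) {t : A.carrier} (x : Term Sg A V t) :
    (x.subst ρ).rename σ = x.subst fun t y => (ρ t y).rename σ := by
  refine TermKit.traverse_traverse (substKit Sg A) (renameKit Sg A) (substKit Sg A) (𝟙 A)
    (fun {V V' W} ρ σ θ => ∀ s (y : V s), θ s y = (ρ s y).rename σ) ?_ ?_ V t x W U ρ σ _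
    fun _ _ => rfl
  · rintro V V' W ρ σ θ u _ rfl h s (y | y)
    · refine (congrArg (Term.rename _) (h s y)).trans ?_
      -- Weakening after `σ` and the extended `σ` after weakening are the same renaming.
      exact (rename_rename _ _ _).trans (rename_rename (fun _ => Sum.inl)
        ((renameKit Sg A).up (g := 𝟙 A) (u := u) rfl σ) (ρ s y)).symm
    · rfl
  · intro V V' W ρ σ θ h s y
    exact (h s y).symm

theorem subst_subst {V W U : A.carrier → Type u} (ρ : ∀ t, V t → Term Sg A W t)
    (σ : ∀ t, W t → Term Sg A U t) {t : A.carrier} (x : Term Sg A V t) :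
    (x.subst ρ).subst σ = x.subst fun t y => (ρ t y).subst σ := by
  refine TermKit.traverse_traverse (substKit Sg A) (substKit Sg A) (substKit Sg A) (𝟙 A)
    (fun {V V' W} ρ σ θ => ∀ s (y : V s), θ s y = (ρ s y).subst σ) ?_ ?_ V t x W U ρ σ _
    fun _ _ => rfl
  · rintro V V' W ρ σ θ u _ rfl h s (y | y)
    · refine (congrArg (Term.rename _) (h s y)).trans ?_
      exact (rename_subst _ _ _).trans (subst_rename (fun _ => Sum.inl)
        ((substKit Sg A).up (g := 𝟙 A) (u := u) rfl σ) (ρ s y)).symm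
    · rfl
  · intro V V' W ρ σ θ h s y
    exact (h s y).symm

theorem traverseArgs_var {n : ℕ} (M : HalfArity S n) :
    ∀ (V : A.carrier → Type u) (ts : Fin n → A.carrier) (a : M.Args A (Term Sg A) V ts)
      (_ : M.ArgsAll (fun _ _ x => x.subst (fun _ => Term.var) = x) V ts a),
      (substKit Sg A).traverseArgs (𝟙 A) ((substKit Sg A).traverse (𝟙 A)) M V ts a V
        (fun _ => Term.var) = a := by
  induction M with
  | one => exact fun _ _ _ _ => rfl
  | fibre τ => exact fun _ _ _ h => h
  | deriv M τ ih =>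
    intro V ts a h
    refine Eq.trans ?_ (ih _ ts a h)
    refine congrArg (TermKit.traverseArgs _ _ _ M _ ts a _) ?_
    -- Extending the assignment of each variable to itself again gives such an assignment.
    funext s y
    cases y <;> rfl
  | prod M N ihM ihN => exact fun _ _ _ h => Prod.ext (ihM _ _ _ h.1) (ihN _ _ _ h.2)

theorem subst_var {V : A.carrier → Type u} {t : A.carrier} (x : Term Sg A V t) :
    x.subst (fun _ => Term.var) = x := by
  induction V, t, x using Term.induction with
  | hv V t x => rfl
  | hc i V ts a ih =>
    refine (subst_con i a _).trans ?_
    exact congrArg (Term.con i) (traverseArgs_var _ V ts a ih)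

/-- Reconciles the weakening used by `substKit` with the functorial action of the monad, which is
substitution of variables. -/
theorem rename_eq_subst {V W : A.carrier → Type u} (ρ : ∀ t, V t → W t) {t : A.carrier}
    (x : Term Sg A V t) : x.rename ρ = x.subst fun t y => Term.var (ρ t y) :=
  (subst_var _).symm.trans (subst_rename ρ _ x)

end Term

/-! ### The representation given by the terms -/

namespace HalfArity

variable {S : AlgSig.{u}} {n : ℕ}

/-- The module of a half-arity consists of the argument lists with entries in the monad. -/
def moduleEquiv (P : SMonad S) : ∀ (M : HalfArity S n) (V : P.sorts.carrier → Type u)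
    (ts : Fin n → P.sorts.carrier), (M.module P).obj (V, Discrete.mk ts) ≃
      M.Args P.sorts (fun V t => P.obj V t) V ts
  | .one, _, _ => Equiv.refl PUnit
  | .fibre τ, V, ts => Equiv.refl (P.obj V (τ.eval P.sorts ts))
  | .deriv M τ, V, ts => M.moduleEquiv P (extend V (τ.eval P.sorts ts)) ts
  | .prod M N, V, ts => (M.moduleEquiv P V ts).prodCongr (N.moduleEquiv P V ts)

end HalfArity

/-- The relative monad of terms, with the equality preorder. -/
def termMonad {S : AlgSig.{u}} (Sg : TermSig S) (A : SRep S) : DeltaMonad A.carrier where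
  obj V t := Delta.obj (Term Sg A V t)
  unit V := DeltaFam.lift fun _ x => (Term.var x : Term Sg A V _)
  bind {_ W} f := fun _ => Delta.map (↾fun x => Term.subst (fun t y => (f t y : Term Sg A W t)) x)
  unit_bind _ := DeltaFam.hom_ext fun _ _ => rfl
  bind_unit _ := funext fun _ => Preord.ext fun x => Term.subst_var x
  bind_bind _ _ := funext fun _ => Preord.ext fun x => Term.subst_subst _ _ x
  bind_mono {_ W} f g h t x := by
    have e : (fun t y => (f t y : Term Sg A W t)) = fun t y => (g t y : Term Sg A W t) := by
      funext t y
      exact h t y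
    exact congrArg (fun k => Term.subst k x) e

/-- The relative monad of terms, together with the types. -/
def termSMonad {S : AlgSig.{u}} (Sg : TermSig S) (A : SRep S) : SMonad S where
  sorts := A
  mon := termMonad Sg A

section

variable {S : AlgSig.{u}} (Sg : TermSig S) (A : SRep S) {n : ℕ}

theorem termMonad_map {V W : A.carrier → Type u} (f : V ⟶ W) (t : A.carrier)
    (x : Term Sg A V t) : (termMonad Sg A).map f t x = Term.rename (fun t y => f t y) x :=
  (Term.rename_eq_subst _ x).symm

/-- This is what makes the constructors monotone. -/
theorem module_termSMonad_discrete (M : HalfArity S n) :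
    ∀ (V : A.carrier → Type u) (ts : Fin n → A.carrier)
      (x y : (M.module (termSMonad Sg A)).obj (V, Discrete.mk ts)), x ≤ y → x = y := by
  induction M with
  | one => exact fun _ _ _ _ _ => rfl
  | fibre τ => exact fun _ _ _ _ h => h
  | deriv M τ ih => exact fun _ _ _ _ h => ih _ _ _ _ h
  | prod M N ihM ihN => exact fun _ _ _ _ h => Prod.ext (ihM _ _ _ _ h.1) (ihN _ _ _ _ h.2)

/-- Identifies the abstract module structure with substitution in argument lists. In the derivation
case, the monad's `shift` agrees with the extension `up` of the assignment. -/
theorem moduleEquiv_bind (M : HalfArity S n) :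
    ∀ (V W : A.carrier → Type u) (ts : Fin n → A.carrier)
      (f : (DeltaFam A.carrier).obj V ⟶ (termMonad Sg A).obj W)
      (a : (M.module (termSMonad Sg A)).obj (V, Discrete.mk ts)),
      M.moduleEquiv (termSMonad Sg A) W ts ((M.module (termSMonad Sg A)).bind
        (X := (V, Discrete.mk ts)) (Y := (W, Discrete.mk ts)) (f, 𝟙 (Discrete.mk ts)) a) =
      (substKit Sg A).traverseArgs (𝟙 A) ((substKit Sg A).traverse (𝟙 A)) M V ts
        (M.moduleEquiv (termSMonad Sg A) V ts a) W (fun t y => f t y) := by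
  induction M with
  | one => exact fun _ _ _ _ _ => rfl
  | fibre τ => exact fun _ _ _ _ _ => rfl
  | deriv M τ ih =>
    intro V W ts f a
    refine (ih _ _ ts ((termMonad Sg A).shift rfl f) a).trans ?_
    refine congrArg (TermKit.traverseArgs _ _ _ M _ ts _ _) ?_
    funext s y
    obtain y | y := y
    · exact termMonad_map Sg A _ s (f s y)
    · rfl
  | prod M N ihM ihN => exact fun _ _ _ _ _ => Prod.ext (ihM _ _ _ _ _) (ihN _ _ _ _ _)

end

/-- The representation of a 1-signature given by the terms with types in `A`. -/
def termRep (Sg : OneSig.{u}) (A : SRep Sg.types) : RepDelta Sg where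
  smon := termSMonad Sg.terms A
  con i := RelModule.Hom.mk
    (fun X => Preord.ofHom (Y := (termMonad Sg.terms A).obj X.1
        ((Sg.terms.arity i).target.eval A X.2.as)) ⟨fun a => Term.con i ((Sg.terms.arity i).dom.moduleEquiv
        (termSMonad Sg.terms A) X.1 X.2.as a),
      fun _ _ h => congrArg (fun a => Term.con i ((Sg.terms.arity i).dom.moduleEquiv
        (termSMonad Sg.terms A) X.1 X.2.as a))
          (module_termSMonad_discrete Sg.terms A (Sg.terms.arity i).dom X.1 X.2.as _ _ h)⟩)
    (by
      rintro ⟨V, ⟨t⟩⟩ ⟨W, ⟨t'⟩⟩ ⟨k, ⟨⟨h⟩⟩⟩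
      change t = t' at h
      subst h
      refine Preord.ext fun a => ?_
      refine (congrArg (Term.con i)
        (moduleEquiv_bind Sg.terms A (Sg.terms.arity i).dom V W t k a)).trans ?_
      exact (Term.subst_con i _ (fun t y => k t y)).symm)

section

variable (Sg : OneSig.{u}) (A : SRep Sg.types)

theorem termRep_all (p : ∀ (V : A.carrier → Type u) (t : A.carrier), Term Sg.terms A V t → Prop)
    {n : ℕ} (M : HalfArity Sg.types n) :
    ∀ (V : A.carrier → Type u) (ts : Fin n → A.carrier)
      (a : M.Args A (Term Sg.terms A) V ts), M.ArgsAll p V ts a →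
      (termRep Sg A).All p M V ts ((M.moduleEquiv (termSMonad Sg.terms A) V ts).symm a) := by
  induction M with
  | one => exact fun _ _ _ _ => trivial
  | fibre τ => exact fun _ _ _ h => h
  | deriv M τ ih => exact fun _ _ _ h => ih _ _ _ h
  | prod M N ihM ihN => exact fun _ _ _ h => ⟨ihM _ _ _ h.1, ihN _ _ _ h.2⟩

theorem termRep_app_symm (i : Sg.terms.Con) {V : A.carrier → Type u}
    {ts : Fin (Sg.terms.arity i).degree → A.carrier}
    (a : (Sg.terms.arity i).dom.Args A (Term Sg.terms A) V ts) :
    (termRep Sg A).app i (((Sg.terms.arity i).dom.moduleEquiv (termSMonad Sg.terms A) V ts).symm a)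
      = Term.con i a :=
  congrArg (Term.con i) (Equiv.apply_symm_apply _ a)

/-- Injectivity comes from applying `Term.dest` to both sides, surjectivity from case analysis on
the term. -/
theorem termRep_freelyGenerated : (termRep Sg A).FreelyGenerated where
  bijective V := by
    constructor
    · rintro (⟨t, x⟩ | ⟨i, ts, a⟩) (⟨t', x'⟩ | ⟨i', ts', a'⟩) h
      · exact congrArg Sum.inl (Sum.inl.inj (congrArg Term.dest h))
      · exact absurd (congrArg Term.dest h) Sum.inl_ne_inr
      · exact absurd (congrArg Term.dest h) Sum.inr_ne_inl
      · have h' := (Term.dest_con i _).symm.trans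
          ((congrArg Term.dest h).trans (Term.dest_con i' _))
        obtain ⟨rfl, h'⟩ := Sigma.mk.inj (Sum.inr.inj h')
        obtain ⟨rfl, h'⟩ := Sigma.mk.inj (eq_of_heq h')
        obtain rfl := (Equiv.injective _) (eq_of_heq h')
        rfl
    · intro x
      obtain ⟨t, y, rfl⟩ | ⟨i, ts, a, rfl⟩ := Term.exists_of_sigma x
      · exact ⟨.inl ⟨t, y⟩, rfl⟩
      · exact ⟨.inr ⟨i, ts, ((Sg.terms.arity i).dom.moduleEquiv (termSMonad Sg.terms A) V ts).symm a⟩,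
          congrArg (Sigma.mk _) (termRep_app_symm Sg A i a)⟩
  induction p hv hc V t x := Term.induction (q := p) hv
    (fun i V ts a h => (congrArg (p V _) (termRep_app_symm Sg A i a)).mp
      (hc i V ts _ (termRep_all Sg A p _ V ts a h))) V t x

end

/-! ### Interpretation of terms in a representation -/

namespace RepDelta

variable {Sg : OneSig.{u}} (R : RepDelta Sg)

/-- The algebra underlying a representation. -/
def alg : TermAlg Sg.terms R.smon.sorts where
  obj W t := R.Tm W t
  con i W ts a := R.app i (((Sg.terms.arity i).dom.moduleEquiv R.smon W ts).symm a)

/-- The kit for interpreting terms in a representation: the values are its terms. -/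
def kit : TermKit R.alg where
  val W t := R.Tm W t
  weaken {W u t} x := R.smon.mon.map (extendInl W u) t x
  fresh h := R.var (.inr h)
  quote x := x

variable {R} {A : SRep Sg.types} (g : A ⟶ R.smon.sorts)

/-- The interpretation of a term in a representation, given values for its variables. -/
def eval {V : A.carrier → Type u} {s : A.carrier} (x : Term Sg.terms A V s)
    {W : R.Ty → Type u} (ρ : ∀ s, V s → R.Tm W (g.map s)) : R.Tm W (g.map s) :=
  R.kit.traverse g V s x W ρ

/-- The interpretation of argument lists, given values for the variables. -/
def evalArgs {n : ℕ} (M : HalfArity Sg.types n) {V : A.carrier → Type u} {ts : Fin n → A.carrier}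
    (a : M.Args A (Term Sg.terms A) V ts) {W : R.Ty → Type u} (ρ : ∀ s, V s → R.Tm W (g.map s)) :
    R.Args M W fun j => g.map (ts j) :=
  (M.moduleEquiv R.smon W _).symm (R.kit.traverseArgs g (R.kit.traverse g) M V ts a W ρ)

theorem eval_con (i : Sg.terms.Con) {V : A.carrier → Type u}
    {ts : Fin (Sg.terms.arity i).degree → A.carrier}
    (a : (Sg.terms.arity i).dom.Args A (Term Sg.terms A) V ts) {W : R.Ty → Type u}
    (ρ : ∀ s, V s → R.Tm W (g.map s)) :
    eval g (Term.con i a) ρ = cast (congrArg (fun t => (R.Tm W t : Type u))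
      (STerm.map_eval g (Sg.terms.arity i).target ts).symm)
        (R.app i (evalArgs g (Sg.terms.arity i).dom a ρ)) :=
  R.kit.traverse_con g i a W ρ

theorem apply_cast {T : Type u} {P Q : T → Preord.{u}} (f : P ⟶ Q) {s t : T} (h : s = t)
    (x : P s) : f t (cast (congrArg (fun t => (P t : Type u)) h) x) =
      cast (congrArg (fun t => (Q t : Type u)) h) (f s x) := by
  subst h
  rfl

theorem bind_var {V W : R.Ty → Type u} (k : (DeltaFam R.Ty).obj V ⟶ R.smon.mon.obj W)
    {t : R.Ty} (x : V t) : R.smon.mon.bind k t (R.var x) = k t x :=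
  congrArg (fun m : (DeltaFam R.Ty).obj V ⟶ R.smon.mon.obj W => m t x) (R.smon.mon.unit_bind k)

/-- The module morphism law of the constructor, read off at an element. -/
theorem bind_app (i : Sg.terms.Con) {V W : R.Ty → Type u}
    {ts : Fin (Sg.terms.arity i).degree → R.Ty} (a : R.Args (Sg.terms.arity i).dom V ts)
    (k : (DeltaFam R.Ty).obj V ⟶ R.smon.mon.obj W) :
    R.smon.mon.bind k _ (R.app i a) = R.app i (((Sg.terms.arity i).dom.module R.smon).bind
      (X := (V, Discrete.mk ts)) (Y := (W, Discrete.mk ts)) (k, 𝟙 (Discrete.mk ts)) a) :=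
  (congrArg (fun m : ((Sg.terms.arity i).dom.module R.smon).obj (V, Discrete.mk ts) ⟶
      ((Sg.terms.arity i).cod.module R.smon).obj (W, Discrete.mk ts) => m a)
    ((R.con i).bind_comm (X := (V, Discrete.mk ts)) (Y := (W, Discrete.mk ts))
      (k, 𝟙 (Discrete.mk ts)))).symm

/-- The binder case of `bind_eval`: substituting commutes with weakening old values, and the fresh
variable is fixed. -/
theorem shift_up {V : A.carrier → Type u} {W U : R.Ty → Type u}
    (ρ : ∀ t, V t → R.Tm W (g.map t)) (k : (DeltaFam R.Ty).obj W ⟶ R.smon.mon.obj U)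
    {u : A.carrier} {u' : R.Ty} (e : g.map u = u') (s : A.carrier) (y : extend V u s) :
    R.smon.mon.bind (R.smon.mon.shift (rfl : u' = u') k) _ (R.kit.up (W := W) e ρ s y) =
      R.kit.up (W := U) e (fun s y => R.smon.mon.bind k _ (ρ s y)) s y := by
  obtain y | y := y
  · have h : R.smon.mon.map (extendInl W u') ≫ R.smon.mon.bind (R.smon.mon.shift rfl k) =
        R.smon.mon.bind k ≫ R.smon.mon.map (extendInl U u') := by
      rw [R.smon.mon.map_bind, R.smon.mon.bind_map]
      rfl
    exact congrArg (fun m : R.smon.mon.obj W ⟶ R.smon.mon.obj (extend U u') => m _ (ρ s y)) h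
  · exact bind_var (R.smon.mon.shift rfl k) _

theorem bind_evalArgs_of_all {n : ℕ} (M : HalfArity Sg.types n) :
    ∀ (V : A.carrier → Type u) (ts : Fin n → A.carrier) (a : M.Args A (Term Sg.terms A) V ts)
      (_ : M.ArgsAll (fun V _ x => ∀ (W U : R.Ty → Type u) (ρ : ∀ s, V s → R.Tm W (g.map s))
        (k : (DeltaFam R.Ty).obj W ⟶ R.smon.mon.obj U),
        R.smon.mon.bind k _ (eval g x ρ) = eval g x fun s y => R.smon.mon.bind k _ (ρ s y)) V ts a)
      (W U : R.Ty → Type u) (ρ : ∀ s, V s → R.Tm W (g.map s))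
      (k : (DeltaFam R.Ty).obj W ⟶ R.smon.mon.obj U),
      (M.module R.smon).bind (X := (W, Discrete.mk fun j => g.map (ts j)))
        (Y := (U, Discrete.mk fun j => g.map (ts j))) (k, 𝟙 _) (evalArgs g M a ρ) =
        evalArgs g M a fun s y => R.smon.mon.bind k _ (ρ s y) := by
  induction M with
  | one => exact fun _ _ _ _ _ _ _ _ => rfl
  | fibre τ =>
    intro V ts a h W U ρ k
    refine (apply_cast (R.smon.mon.bind k) (STerm.map_eval g τ ts) (eval g a ρ)).trans ?_
    exact congrArg (cast _) (h W U ρ k)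
  | deriv M τ ih =>
    intro V ts a h W U ρ k
    refine (ih _ ts a h _ _ _ (R.smon.mon.shift rfl k)).trans ?_
    refine congrArg (fun ρ => evalArgs g M a ρ) ?_
    funext s y
    exact shift_up g ρ k _ s y
  | prod M N ihM ihN =>
    intro V ts a h W U ρ k
    exact Prod.ext (ihM V ts a.1 h.1 W U ρ k) (ihN V ts a.2 h.2 W U ρ k)

/-- Substitution after interpretation is interpretation with substituted values. -/
theorem bind_eval {V : A.carrier → Type u} {s : A.carrier} (x : Term Sg.terms A V s) :
    ∀ (W U : R.Ty → Type u) (ρ : ∀ s, V s → R.Tm W (g.map s))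
      (k : (DeltaFam R.Ty).obj W ⟶ R.smon.mon.obj U),
      R.smon.mon.bind k _ (eval g x ρ) = eval g x fun s y => R.smon.mon.bind k _ (ρ s y) := by
  induction V, s, x using Term.induction with
  | hv V s x => exact fun _ _ _ _ => rfl
  | hc i V ts a ih =>
    intro W U ρ k
    rw [eval_con, eval_con]
    refine (apply_cast (R.smon.mon.bind k)
      (STerm.map_eval g (Sg.terms.arity i).target ts).symm _).trans (congrArg (cast _) ?_)
    refine (bind_app i _ k).trans (congrArg (R.app i) ?_)
    exact bind_evalArgs_of_all g _ V ts a ih W U ρ k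

theorem bind_evalArgs {n : ℕ} (M : HalfArity Sg.types n) {V : A.carrier → Type u}
    {ts : Fin n → A.carrier} (a : M.Args A (Term Sg.terms A) V ts) {W U : R.Ty → Type u}
    (ρ : ∀ s, V s → R.Tm W (g.map s)) (k : (DeltaFam R.Ty).obj W ⟶ R.smon.mon.obj U) :
    (M.module R.smon).bind (X := (W, Discrete.mk fun j => g.map (ts j)))
      (Y := (U, Discrete.mk fun j => g.map (ts j))) (k, 𝟙 _) (evalArgs g M a ρ) =
      evalArgs g M a fun s y => R.smon.mon.bind k _ (ρ s y) :=
  bind_evalArgs_of_all g M V ts a (M.argsAll_of_forall (fun _ _ => bind_eval g) V ts a) W U ρ k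

theorem eval_rename {V V' : A.carrier → Type u} {W : R.Ty → Type u} (ρ : ∀ s, V s → V' s)
    (σ : ∀ s, V' s → R.Tm W (g.map s)) {s : A.carrier} (x : Term Sg.terms A V s) :
    eval g (x.rename ρ) σ = eval g x fun s y => σ s (ρ s y) := by
  refine TermKit.traverse_traverse (renameKit Sg.terms A) R.kit R.kit g
    (fun {V V' W} ρ σ θ => ∀ s (y : V s), θ s y = σ s (ρ s y)) ?_ ?_ V s x V' W ρ σ _
    fun _ _ => rfl
  · rintro V V' W ρ σ θ u _ rfl h s (y | y)
    · exact congrArg (R.smon.mon.map _ _) (h s y)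
    · rfl
  · intro V V' W ρ σ θ h s y
    exact (h s y).symm

/-- Interpretation after substitution is interpretation with interpreted values. -/
theorem eval_subst {V V' : A.carrier → Type u} {W : R.Ty → Type u}
    (ρ : ∀ s, V s → Term Sg.terms A V' s) (σ : ∀ s, V' s → R.Tm W (g.map s)) {s : A.carrier}
    (x : Term Sg.terms A V s) :
    eval g (x.subst ρ) σ = eval g x fun s y => eval g (ρ s y) σ := by
  refine TermKit.traverse_traverse (substKit Sg.terms A) R.kit R.kit g
    (fun {V V' W} ρ σ θ => ∀ s (y : V s), θ s y = eval g (ρ s y) σ) ?_ ?_ V s x V' W ρ σ _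
    fun _ _ => rfl
  · rintro V V' W ρ σ θ u _ rfl h s (y | y)
    · refine (congrArg (R.smon.mon.map (extendInl W (g.map u)) _) (h s y)).trans ?_
      -- Weakening in `R` is itself a `bind`, so it can be moved onto the values of the variables.
      refine (bind_eval g (ρ s y) W _ σ _).trans ?_
      exact (eval_rename g (fun _ => Sum.inl) (R.kit.up (u := u) (W := W) rfl σ) (ρ s y)).symm
    · rfl
  · intro V V' W ρ σ θ h s y
    exact (h s y).symm

/-! ### Initiality -/

/-- Each variable is its own value, up to retyping. -/
def retypeVar (V : A.carrier → Type u) (s : A.carrier) (y : V s) :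
    R.Tm ((retype g.map).obj V) (g.map s) :=
  R.var (V := (retype g.map).obj V) (⟨⟨s, rfl⟩, y⟩ : Σ r : {r // g.map r = g.map s}, V r)

/-- The morphism of relative monads given by the interpretation of terms. -/
def evalHom : termSMonad Sg.terms A ⟶ R.smon where
  sort := g
  colax :=
    -- A map out of the retyped family is given by its transpose, a map on terms of type `s` into
    -- type `g s`.
    { τ := fun V => (((retypePOAdj g.map).homEquiv ((termMonad Sg.terms A).obj V)
          (R.smon.mon.obj ((retype g.map).obj V))).symm fun s =>
        Preord.ofHom (X := (termMonad Sg.terms A).obj V s)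
          (Y := R.smon.mon.obj ((retype g.map).obj V) (g.map s))
          ⟨fun x => eval g x (retypeVar g V),
            fun _ _ h => le_of_eq (congrArg (eval g · (retypeVar g V)) h)⟩)
      bind_comm := by
        intro V W f
        funext t
        refine Preord.ext ?_
        rintro ⟨⟨s, rfl⟩, x⟩
        -- Both sides become interpretations of `x`, and only the values of the variables need
        -- comparing.
        refine (eval_subst g _ _ x).trans (Eq.trans ?_ (bind_eval g x _ _ _ _).symm)
        refine congrArg (fun ρ => eval g x ρ) ?_
        funext s y
        refine Eq.trans ?_ (bind_var _ _).symm
        rfl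
      unit_comm := by
        intro V
        refine DeltaFam.hom_ext ?_
        rintro t ⟨⟨s, rfl⟩, x⟩
        rfl }

theorem app_eq_cast {P Q : SMonad Sg.types} (f : P ⟶ Q) (V : P.sorts.carrier → Type u)
    {s : P.sorts.carrier} {t : Q.sorts.carrier} (h : f.sort.map s = t) (x : P.obj V s) :
    f.app V h x = cast (congrArg (fun t => (Q.obj ((retype f.sort.map).obj V) t : Type u)) h)
      (f.app V rfl x) := by
  subst h
  rfl

/-- The binder case of `map_app_eq_evalArgs`: extending then retyping agrees, on variables, with
retyping then extending. -/
theorem map_retypeExtend (V : A.carrier → Type u) {u : A.carrier} {u' : R.Ty} (e : g.map u = u')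
    (s : A.carrier) (y : extend V u s) :
    R.smon.mon.map (retypeExtend g.map V e) _ (retypeVar g (extend V u) s y) =
      R.kit.up (W := (retype g.map).obj V) e (retypeVar g V) s y := by
  refine (SMonad.map_unit_apply R.smon (retypeExtend g.map V e) _ _).trans ?_
  obtain y | y := y
  · exact (SMonad.map_unit_apply R.smon (extendInl ((retype g.map).obj V) u') _ _).symm
  · rfl

/-- A morphism of relative monads which is the interpretation on the entries of an argument list
is the interpretation on the argument list. -/
theorem map_app_eq_evalArgs (f : termSMonad Sg.terms A ⟶ R.smon) {n : ℕ}
    (M : HalfArity Sg.types n) :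
    ∀ (V : A.carrier → Type u) (ts : Fin n → A.carrier)
      (a : (M.module (termSMonad Sg.terms A)).obj (V, Discrete.mk ts)),
      M.ArgsAll (fun V s (x : Term Sg.terms A V s) =>
        f.app V rfl x = eval f.sort x (retypeVar f.sort V)) V ts
        (M.moduleEquiv (termSMonad Sg.terms A) V ts a) →
      (M.map f).app (V, Discrete.mk ts) a =
        evalArgs f.sort M (M.moduleEquiv (termSMonad Sg.terms A) V ts a) (retypeVar f.sort V) := by
  induction M with
  | one => exact fun _ _ _ _ => rfl
  | fibre τ =>
    intro V ts a h
    exact (app_eq_cast f V (STerm.map_eval f.sort τ ts) a).trans (congrArg (cast _) h)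
  | deriv M τ ih =>
    intro V ts a h
    refine (congrArg ((M.module R.smon).map
      (X := ((retype f.sort.map).obj (extend V (τ.eval A ts)),
        Discrete.mk fun i => f.sort.map (ts i)))
      (Y := (extend ((retype f.sort.map).obj V) (τ.eval R.smon.sorts fun i => f.sort.map (ts i)),
        Discrete.mk fun i => f.sort.map (ts i)))
      (retypeExtend f.sort.map V (STerm.map_eval f.sort τ ts), 𝟙 _)) (ih _ ts a h)).trans ?_
    refine (bind_evalArgs f.sort M _ _ _).trans ?_
    refine congrArg (fun ρ => evalArgs f.sort M _ ρ) ?_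
    funext s y
    exact map_retypeExtend f.sort V (STerm.map_eval f.sort τ ts) s y
  | prod M N ihM ihN =>
    exact fun V ts a h => Prod.ext (ihM V ts a.1 h.1) (ihN V ts a.2 h.2)

/-- The morphism of representations given by the interpretation of terms. -/
def evalRepHom : termRep Sg A ⟶ R where
  hom := evalHom g
  comm i := by
    refine RelModule.Hom.ext (funext fun X => Preord.ext fun a => ?_)
    obtain ⟨V, ⟨ts⟩⟩ := X
    refine (app_eq_cast (evalHom g) V
      (STerm.map_eval g (Sg.terms.arity i).target ts) ((termRep Sg A).app i a)).trans ?_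
    refine (congrArg (cast _) (eval_con g i _ _)).trans ?_
    -- The cast from `app_eq_cast` and the one from `eval_con` are mutually inverse.
    refine (cast_cast _ _ _).trans ?_
    exact congrArg (R.app i) (map_app_eq_evalArgs (evalHom g) (Sg.terms.arity i).dom V ts a
      ((Sg.terms.arity i).dom.argsAll_of_forall (fun _ _ _ => rfl) V ts _)).symm

/-- Uniqueness: the unit law forces the value on variables, and the arity law forces it on a
constructor once it is known on the arguments. -/
theorem hom_app_eq_eval (f : termRep Sg A ⟶ R) {V : A.carrier → Type u} {s : A.carrier}
    (x : Term Sg.terms A V s) :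
    f.hom.app V rfl x = eval f.hom.sort x (retypeVar f.hom.sort V) := by
  induction V, s, x using Term.induction with
  | hv V s x => exact SMonad.Hom.app_unit f.hom V rfl x
  | hc i V ts a ih =>
    let M := (Sg.terms.arity i).dom
    let E := M.moduleEquiv (termSMonad Sg.terms A) V ts
    have hmap : (M.map f.hom).app (V, Discrete.mk ts) (E.symm a) =
        evalArgs f.hom.sort M a (retypeVar f.hom.sort V) := by
      have e : E (E.symm a) = a := E.apply_symm_apply a
      refine (map_app_eq_evalArgs f.hom M V ts (E.symm a) ?_).trans
        (congrArg (fun b => evalArgs f.hom.sort M b (retypeVar f.hom.sort V)) e)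
      exact (congrArg (M.ArgsAll _ V ts) e).mpr ih
    have hcon : f.hom.app V (STerm.map_eval f.hom.sort (Sg.terms.arity i).target ts)
        (Term.con i a) = R.app i (evalArgs f.hom.sort M a (retypeVar f.hom.sort V)) :=
      (congrArg (f.hom.app V _) (termRep_app_symm Sg A i a)).symm.trans
        ((congrArg (fun k : (Sg.terms.arity i).dom.module (termRep Sg A).smon ⟶ _ =>
            k.app (V, Discrete.mk ts) (E.symm a)) (f.comm i)).trans
          (congrArg (R.app i) hmap))
    refine Eq.trans ?_ (eval_con f.hom.sort i a _).symm
    exact eq_cast_iff_heq.mpr (cast_eq_iff_heq.mp ((app_eq_cast f.hom V _ _).symm.trans hcon))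

end RepDelta

/-! ### Initial types and the conclusion -/

/-- The initial representation of an algebraic signature: the closed terms. -/
def closedTerms (S : AlgSig.{u}) : SRep S where
  carrier := STerm S 0
  op := STerm.op

/-- The closed terms are initial. -/
def closedTermsIsInitial (S : AlgSig.{u}) : Limits.IsInitial (closedTerms S) :=
  Limits.IsInitial.ofUniqueHom
    (fun B => ⟨fun s => s.eval B Fin.elim0, fun _ _ => rfl⟩)
    (fun B m => SRep.Hom.ext (funext fun s => by
      induction s with
      | var j => exact j.elim0
      | op o a ih =>
        exact (m.map_op o a).trans (congrArg (B.op o) (funext ih))))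

/-- The terms over initial types are an initial representation. -/
def termRepIsInitial (Sg : OneSig.{u}) {A : SRep Sg.types} (hA : Limits.IsInitial A) :
    Limits.IsInitial (termRep Sg A) :=
  Limits.IsInitial.ofUniqueHom (fun R => RepDelta.evalRepHom (hA.to R.smon.sorts))
    (fun R m => by
      obtain ⟨⟨g, c⟩, hm⟩ := m
      -- The type of the colax morphism depends on the map of types, so the maps of types are
      -- identified before the actions on terms are compared.
      obtain rfl : g = hA.to R.smon.sorts := hA.hom_ext _ _
      refine RepDelta.Hom.ext (SMonad.Hom.ext_app _ _ _ fun V s x => ?_)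
      exact RepDelta.hom_app_eq_eval (R := R) ⟨⟨_, c⟩, hm⟩ x)

theorem mainTheorem2 (Sg : OneSig.{u}) :
    ∃ I : RepDelta Sg, Nonempty (Limits.IsInitial I) ∧
      Nonempty (Limits.IsInitial I.smon.sorts) ∧ I.FreelyGenerated ∧
      ∀ (V : I.Ty → Type u) (t : I.Ty) (x y : I.Tm V t), x ≤ y ↔ x = y :=
  ⟨termRep Sg (closedTerms Sg.types), ⟨termRepIsInitial Sg (closedTermsIsInitial Sg.types)⟩,
    ⟨closedTermsIsInitial Sg.types⟩, termRep_freelyGenerated Sg _, fun _ _ _ _ => Iff.rfl⟩
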